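/- Let $p\ge 1$ and let $X=(X_1,X_2,\ldots)$ be a sequence of $\mathbb{R}^p$-valued random variables on a probability space $(\Omega,\mathcal{F},P)$. For $a\in\mathbb{R}^p$ and a symmetric non-negative definite $p\times p$ matrix $B$, let $\mathcal{N}(a,B)$ be the (possibly degenerate) Gaussian distribution with mean $a$ and covariance matrix $B$, i.e. the law of $a+B^{1/2}Z$ with $Z$ standard Gaussian in $\mathbb{R}^p$. For $n\ge 1$ put $$M_n=\frac1n\sum_{i=1}^nX_i,\qquad Q_n=\frac1n\sum_{i=1}^n(X_i-M_n)(X_i-M_n)^t,$$ and let $\alpha_0=\mathcal{N}(0,I)$, $\alpha_1=\mathcal{N}(X_1,I)$ and $\alpha_n=\mathcal{N}(M_n,Q_n)$ for $n\ge 2$. Suppose that the $\alpha_n$ are the predictive distributions of $X$ under $P$, that is, $P(X_1\in\cdot)=\alpha_0$ and $P(X_{n+1}\in\cdot\mid X_1,\ldots,X_n)=\alpha_n$ a.s. for every $n\ge 1$. Then $M_n\to M$ and $Q_n\to Q$ a.s. for some random vector $M$ and random matrix $Q$. Moreover, with $\alpha=\mathcal{N}(M,Q)$ and with $\|\mu-\nu\|=\sup_A|\mu(A)-\nu(A)|$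 (supremum over the Borel sets $A$) the total variation distance, every sequence $(d_n)$ of real constants such that $d_n/\sqrt n\to 0$ satisfies $$d_n\,\|\alpha_n-\alpha\|\longrightarrow 0\quad\text{in probability under }P.$$ -/

import Mathlib

open MeasureTheory ProbabilityTheory Filter Topology

noncomputable section

namespace PredictiveGaussian

/-- The total variation distance `sup_A |μ(A) - ν(A)|`, the supremum being over measurable sets. -/
def tvDist {S : Type*} [MeasurableSpace S] (μ ν : Measure S) : ℝ :=
  ⨆ A : {A : Set S // MeasurableSet A}, |μ.real A.1 - ν.real A.1|

variable {p : ℕ} {Ω : Type*}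

/-- The sample mean `M_n` of the first `n` observations. The sequence is indexed from `0`: the
observations `X_1, X_2, …` are `X 0, X 1, …`, so the first `n` of them are `X i` with `i < n`. -/
def sampleMean (X : ℕ → Ω → EuclideanSpace ℝ (Fin p)) (n : ℕ) (ω : Ω) :
    EuclideanSpace ℝ (Fin p) :=
  (n : ℝ)⁻¹ • ∑ i ∈ Finset.range n, X i ω

/-- The sample covariance matrix `Q_n = (1/n) ∑ (X_i - M_n)(X_i - M_n)ᵗ` of the first `n`
observations. -/
def sampleCov (X : ℕ → Ω → EuclideanSpace ℝ (Fin p)) (n : ℕ) (ω : Ω) :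
    Matrix (Fin p) (Fin p) ℝ :=
  (n : ℝ)⁻¹ • ∑ i ∈ Finset.range n,
    Matrix.vecMulVec (X i ω - sampleMean X n ω).ofLp (X i ω - sampleMean X n ω).ofLp

/-- The random probability measures `α_0 = N(0, I)`, `α_1 = N(X_1, I)` and
`α_n = N(M_n, Q_n)` for `n ≥ 2`. -/
def gaussianPredictive (X : ℕ → Ω → EuclideanSpace ℝ (Fin p)) :
    ℕ → Ω → Measure (EuclideanSpace ℝ (Fin p))
  | 0, _ => multivariateGaussian 0 1
  | 1, ω => multivariateGaussian (X 0 ω) 1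
  | n + 2, ω => multivariateGaussian (sampleMean X (n + 2) ω) (sampleCov X (n + 2) ω)

/-- `α` is the sequence of predictive distributions of `X` under `P`: for every `n` and every
measurable `A`, `α_n(·, A)` is a version of the conditional probability that the `(n+1)`-th
observation `X n` lies in `A`, given the first `n` observations. For `n = 0` the conditioning
σ-algebra is trivial, so that `α_0` is the law of the first observation. -/
def HasPredictives {S : Type*} [MeasurableSpace S] [MeasurableSpace Ω] (P : Measure Ω)
    (X : ℕ → Ω → S) (α : ℕ → Ω → Measure S) : Prop :=
  ∀ (n : ℕ) (A : Set S), MeasurableSet A →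
    P⟦X n ⁻¹' A | MeasurableSpace.comap (fun ω (i : Fin n) => X i ω) inferInstance⟧
      =ᵐ[P] fun ω => (α n ω).real A

end PredictiveGaussian

end

/-! The multivariate problem is one-dimensional in disguise. Almost surely `X 1 ≠ X 0`, and the
empirical covariance of two points has rank one, so the predictive law of the third observation
lives on the line through them; inductively all observations stay on this line (`ae_obs_mem_line`).
In the coordinate putting the first two at 0 and 1, the standardized innovations Z are standard
Gaussian and independent of the past (`innovation_indep_law`).

The coordinate mean m and the normalized variance U = n/(n+1) · (empirical variance) are then
explicit martingales driven by Z, with U multiplied at each step by 1 + (Z² - 1)/(n+2)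
(`procs_innovation`). Since E U² stays bounded, their steps have L² norm O(1/n). Hence they converge
a.s., their squared L² distance to the limit is O(1/n), and Chebyshev gives every rate o(√n)
(`IsDampedWalk.tendstoInMeasure`).

To carry this over to total variation, the distance between two real Gaussians is bounded by
relative differences of mean and variance (`tvDist_gaussianReal_le`), and mapping onto the line does
not increase it. The bound divides by the limit variance, which is positive because E(1/U) is
bounded too (`IsGaussianNoise.ae_limit_scaleProc_pos`). -/

noncomputable section

namespace PredictiveGaussian

/-! ### Total variation distance -/

section TotalVariation

variable {S T : Type*} [MeasurableSpace S] [MeasurableSpace T]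

lemma abs_real_sub_real_le_one (μ ν : Measure S) [IsProbabilityMeasure μ] [IsProbabilityMeasure ν]
    (A : Set S) : |μ.real A - ν.real A| ≤ 1 := by
  have h1 : μ.real A ≤ 1 := measureReal_le_one
  have h2 : ν.real A ≤ 1 := measureReal_le_one
  have h3 : 0 ≤ μ.real A := measureReal_nonneg
  have h4 : 0 ≤ ν.real A := measureReal_nonneg
  rw [abs_le]
  constructor <;> linarith

lemma le_tvDist (μ ν : Measure S) [IsProbabilityMeasure μ] [IsProbabilityMeasure ν]
    {A : Set S} (hA : MeasurableSet A) : |μ.real A - ν.real A| ≤ tvDist μ ν :=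
  le_ciSup (f := fun A : {A : Set S // MeasurableSet A} => |μ.real A.1 - ν.real A.1|)
    ⟨1, by rintro _ ⟨A, rfl⟩; exact abs_real_sub_real_le_one μ ν A.1⟩ ⟨A, hA⟩

lemma tvDist_le {μ ν : Measure S} {c : ℝ}
    (h : ∀ A, MeasurableSet A → |μ.real A - ν.real A| ≤ c) : tvDist μ ν ≤ c := by
  have : Nonempty {A : Set S // MeasurableSet A} := ⟨⟨∅, MeasurableSet.empty⟩⟩
  exact ciSup_le fun A => h A.1 A.2

lemma tvDist_nonneg (μ ν : Measure S) : 0 ≤ tvDist μ ν :=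
  Real.iSup_nonneg fun _ => abs_nonneg _

lemma tvDist_le_one (μ ν : Measure S) [IsProbabilityMeasure μ] [IsProbabilityMeasure ν] :
    tvDist μ ν ≤ 1 :=
  tvDist_le fun A _ => abs_real_sub_real_le_one μ ν A

lemma tvDist_comm (μ ν : Measure S) : tvDist μ ν = tvDist ν μ := by
  simp only [tvDist, abs_sub_comm]

lemma tvDist_triangle (μ ν ρ : Measure S) [IsProbabilityMeasure μ] [IsProbabilityMeasure ν]
    [IsProbabilityMeasure ρ] : tvDist μ ρ ≤ tvDist μ ν + tvDist ν ρ :=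
  tvDist_le fun A hA => (abs_sub_le _ (ν.real A) _).trans
    (add_le_add (le_tvDist μ ν hA) (le_tvDist ν ρ hA))

lemma tvDist_map_le (μ ν : Measure S) [IsProbabilityMeasure μ] [IsProbabilityMeasure ν]
    {f : S → T} (hf : Measurable f) : tvDist (μ.map f) (ν.map f) ≤ tvDist μ ν := by
  refine tvDist_le fun A hA => ?_
  rw [map_measureReal_apply hf hA, map_measureReal_apply hf hA]
  exact le_tvDist μ ν (hf hA)

/-- One-sided domination suffices: the excess on A is at most (K - 1) ν(A), and passing to the
complement of A bounds the deficit. -/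
lemma tvDist_le_of_real_le_mul (μ ν : Measure S) [IsProbabilityMeasure μ] [IsProbabilityMeasure ν]
    {K : ℝ} (hK : 1 ≤ K) (h : ∀ A, MeasurableSet A → μ.real A ≤ K * ν.real A) :
    tvDist μ ν ≤ K - 1 := by
  have key : ∀ A, MeasurableSet A → μ.real A - ν.real A ≤ K - 1 := fun A hA => by
    have h1 : ν.real A ≤ 1 := measureReal_le_one
    nlinarith [h A hA]
  refine tvDist_le fun A hA => abs_le.2 ⟨?_, key A hA⟩
  have := key Aᶜ hA.compl
  rw [probReal_compl_eq_one_sub hA, probReal_compl_eq_one_sub hA] at this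
  linarith

end TotalVariation

/-! ### Total variation between real Gaussian laws -/

section Gaussian

open scoped NNReal

/-- With the larger variance on the right, the difference of exponents is a quadratic in x bounded
above. Completing the square shows that its maximum is (a - b)²/(2(t - s)). -/
lemma gaussianPDFReal_le_mul {a b : ℝ} {s t : ℝ≥0} (hs : 0 < s) (hst : s < t) (x : ℝ) :
    gaussianPDFReal a s x ≤
      √(t / s) * Real.exp ((a - b) ^ 2 / (2 * (t - s))) * gaussianPDFReal b t x := by
  have hs' : (0 : ℝ) < s := hs
  have hst' : (s : ℝ) < t := hst
  have ht' : (0 : ℝ) < t := hs'.trans hst'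
  have h1 : √((t : ℝ) / s) * (√(2 * Real.pi * t))⁻¹ = (√(2 * Real.pi * s))⁻¹ := by
    rw [← Real.sqrt_inv, ← Real.sqrt_inv, ← Real.sqrt_mul (by positivity)]
    congr 1
    field_simp
  have h2 : -(x - a) ^ 2 / (2 * s) ≤ (a - b) ^ 2 / (2 * (t - s)) + -(x - b) ^ 2 / (2 * t) := by
    have hd : (0 : ℝ) < t - s := by linarith
    rw [← sub_nonneg]
    have : (a - b) ^ 2 / (2 * (t - s)) + -(x - b) ^ 2 / (2 * t) - -(x - a) ^ 2 / (2 * s)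
        = ((t - s) * (x - a) + s * (b - a)) ^ 2 / (2 * s * t * (t - s)) := by
      field_simp
      ring
    rw [this]
    positivity
  calc gaussianPDFReal a s x = (√(2 * Real.pi * s))⁻¹ * Real.exp (-(x - a) ^ 2 / (2 * s)) := rfl
    _ ≤ (√(2 * Real.pi * s))⁻¹ *
        Real.exp ((a - b) ^ 2 / (2 * (t - s)) + -(x - b) ^ 2 / (2 * t)) := by gcongr
    _ = _ := by
      rw [← h1, Real.exp_add, gaussianPDFReal]
      ring

lemma gaussianReal_real_le_mul {a b : ℝ} {s t : ℝ≥0} (hs : 0 < s) (hst : s < t) (A : Set ℝ) :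
    (gaussianReal a s).real A ≤
      √(t / s) * Real.exp ((a - b) ^ 2 / (2 * (t - s))) * (gaussianReal b t).real A := by
  have e : ∀ (c : ℝ) (r : ℝ≥0), r ≠ 0 →
      (gaussianReal c r).real A = ∫ x in A, gaussianPDFReal c r x := fun c r hr => by
    rw [measureReal_def, gaussianReal_apply_eq_integral _ hr, ENNReal.toReal_ofReal]
    exact integral_nonneg fun x => gaussianPDFReal_nonneg _ _ _
  rw [e a s hs.ne', e b t (hs.trans hst).ne', ← integral_const_mul]
  exact integral_mono (integrable_gaussianPDFReal _ _).integrableOn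
    ((integrable_gaussianPDFReal _ _).integrableOn.const_mul _)
    fun x => gaussianPDFReal_le_mul hs hst x

lemma sqrt_mul_exp_sub_one_le {x y : ℝ} (hx : 0 ≤ x) (hy : 0 ≤ y) (hxy : x / 2 + y ≤ 1) :
    √(1 + x) * Real.exp y - 1 ≤ x + 2 * y := by
  have h1 : √(1 + x) ≤ Real.exp (x / 2) := by
    rw [Real.exp_half]
    exact Real.sqrt_le_sqrt (by linarith [Real.add_one_le_exp x])
  have h2 : √(1 + x) * Real.exp y ≤ Real.exp (x / 2 + y) := by
    rw [Real.exp_add]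
    gcongr
  have h3 := Real.abs_exp_sub_one_le (x := x / 2 + y)
    (by rw [abs_of_nonneg (by positivity)]; exact hxy)
  rw [abs_of_nonneg (a := x / 2 + y) (by positivity)] at h3
  linarith [le_abs_self (Real.exp (x / 2 + y) - 1)]

/-- Comparison of two Gaussian distributions of different variances. -/
lemma tvDist_gaussianReal_le_of_lt {a b : ℝ} {s t : ℝ≥0} (hs : 0 < s) (hst : s < t)
    (h : (t - s : ℝ) / s / 2 + (a - b) ^ 2 / (2 * (t - s)) ≤ 1) :
    tvDist (gaussianReal a s) (gaussianReal b t) ≤ (t - s : ℝ) / s + (a - b) ^ 2 / (t - s) := by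
  have hs' : (0 : ℝ) < s := hs
  have hst' : (0 : ℝ) < t - s := sub_pos.2 hst
  have e : (t : ℝ) / s = 1 + (t - s) / s := by field_simp; ring
  have hK : 1 ≤ √((t : ℝ) / s) * Real.exp ((a - b) ^ 2 / (2 * (t - s))) := by
    refine one_le_mul_of_one_le_of_one_le ?_ (Real.one_le_exp (by positivity))
    rw [Real.one_le_sqrt, e]
    linarith [div_pos hst' hs']
  refine (tvDist_le_of_real_le_mul _ _ hK fun A _ => gaussianReal_real_le_mul hs hst A).trans ?_
  rw [e]
  refine (sqrt_mul_exp_sub_one_le (by positivity) (by positivity) h).trans_eq ?_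
  field_simp

/-- The total variation distance of two real Gaussian distributions is controlled by the
differences of the means and of the variances. -/
theorem tvDist_gaussianReal_le (a b : ℝ) (s : ℝ≥0) {t : ℝ≥0} (ht : 0 < t) :
    tvDist (gaussianReal a s) (gaussianReal b t) ≤ 8 * (|a - b| / √t + |(s : ℝ) - t| / t) := by
  have ht' : (0 : ℝ) < t := ht
  have hr : 0 < √(t : ℝ) := Real.sqrt_pos.2 ht'
  have hrr : √(t : ℝ) * √(t : ℝ) = t := Real.mul_self_sqrt ht'.le
  set δ := |a - b| / √(t : ℝ) with hδ
  set e := |(s : ℝ) - t| / t with he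
  have hδ0 : 0 ≤ δ := by positivity
  have he0 : 0 ≤ e := by positivity
  by_cases hbig : 1 ≤ 8 * (δ + e)
  · exact (tvDist_le_one _ _).trans hbig
  have hsmall : δ + e < 1 / 8 := by push Not at hbig; linarith
  -- The degenerate case is split off because the intermediate variance below must strictly exceed
  -- t.
  rcases eq_or_lt_of_le (add_nonneg hδ0 he0) with h0 | h0
  · have hd : δ = 0 := by linarith
    have hee : e = 0 := by linarith
    have hab : a = b := by
      rw [hδ, div_eq_zero_iff] at hd
      rcases hd with hd | hd
      · exact sub_eq_zero.1 (abs_eq_zero.1 hd)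
      · exact absurd hd hr.ne'
    have hst : s = t := by
      rw [he, div_eq_zero_iff] at hee
      rcases hee with hd | hd
      · exact NNReal.coe_injective (sub_eq_zero.1 (abs_eq_zero.1 hd))
      · exact absurd hd ht'.ne'
    rw [hab, hst, hd, hee]
    exact (tvDist_le (c := 0) fun A _ => by simp).trans (by simp)
  -- compare both laws with the Gaussian law of mean `b` and variance `t (1 + δ + 2 e)`
  have habs : |(s : ℝ) - t| = e * t := by rw [he]; field_simp
  have hs1 : (s : ℝ) - t ≤ e * t := habs ▸ le_abs_self _
  have hs2 : -(e * t) ≤ (s : ℝ) - t := habs ▸ neg_abs_le _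
  have hab2 : (a - b) ^ 2 = δ ^ 2 * t := by
    rw [← sq_abs, hδ, div_pow, Real.sq_sqrt ht'.le]; field_simp
  -- The margin δ + 2e puts r - s between (δ + e)t and (δ + 3e)t. The gap is small enough to cost
  -- O(δ + e) in variance, yet large enough that the mean shift costs only δ²/(δ + e) ≤ δ.
  set r : ℝ≥0 := ⟨t * (1 + δ + 2 * e), by positivity⟩ with hr_def
  have hrv : (r : ℝ) = t * (1 + δ + 2 * e) := rfl
  have htr : t < r := by
    rw [← NNReal.coe_lt_coe, hrv]
    nlinarith
  have hsr : s < r := by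
    rw [← NNReal.coe_lt_coe, hrv]
    nlinarith
  have hs0 : (7 / 8 : ℝ) * t ≤ s := by nlinarith
  have hs0' : 0 < s := by rw [← NNReal.coe_pos]; linarith
  have hrs1 : (r : ℝ) - s ≤ (δ + 3 * e) * t := by rw [hrv]; linarith
  have hrs2 : (δ + e) * t ≤ (r : ℝ) - s := by rw [hrv]; linarith
  have hrspos : (0 : ℝ) < r - s := lt_of_lt_of_le (by positivity) hrs2
  have q1 : ((r : ℝ) - s) / s ≤ 8 / 7 * (δ + 3 * e) := by
    rw [div_le_iff₀ (by exact_mod_cast hs0')]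
    nlinarith
  have q2 : (a - b) ^ 2 / ((r : ℝ) - s) ≤ δ := by
    rw [div_le_iff₀ hrspos, hab2]
    nlinarith [mul_nonneg hδ0 (sub_nonneg.2 hrs2), mul_nonneg (mul_nonneg hδ0 he0) ht'.le]
  have q3 : (a - b) ^ 2 / (2 * ((r : ℝ) - s)) ≤ δ := by
    refine le_trans ?_ q2
    exact div_le_div_of_nonneg_left (sq_nonneg _) hrspos (by linarith)
  have b1 := tvDist_gaussianReal_le_of_lt (a := a) (b := b) hs0' hsr (by linarith)
  have q4 : ((r : ℝ) - t) / t = δ + 2 * e := by rw [hrv]; field_simp; ring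
  have b2 := tvDist_gaussianReal_le_of_lt (a := b) (b := b) ht htr (by rw [q4]; simp; linarith)
  rw [q4] at b2
  simp only [sub_self, ne_eq, OfNat.ofNat_ne_zero, not_false_eq_true, zero_pow, zero_div,
    add_zero] at b2
  rw [tvDist_comm] at b2
  have := tvDist_triangle (gaussianReal a s) (gaussianReal b r) (gaussianReal b t)
  linarith

end Gaussian

/-! ### Conditional laws given the past -/

section ConditionalLaw

variable {Ω S : Type*} [MeasurableSpace Ω] [MeasurableSpace S] {P : Measure Ω}
  [IsProbabilityMeasure P]

/-- Countability allows the almost sure identities, one for each set, to hold off a single null set;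
the π-system property then identifies the measures. -/
lemma exists_countable_piSystem (S : Type*) [m : MeasurableSpace S]
    [MeasurableSpace.CountablyGenerated S] :
    ∃ C : Set (Set S), C.Countable ∧ IsPiSystem C ∧ MeasurableSpace.generateFrom C = m := by
  refine ⟨generateSetAlgebra (MeasurableSpace.countableGeneratingSet S),
    countable_generateSetAlgebra MeasurableSpace.countable_countableGeneratingSet,
    fun s hs t ht _ => isSetAlgebra_generateSetAlgebra.inter_mem hs ht, ?_⟩
  rw [generateFrom_generateSetAlgebra_eq, MeasurableSpace.generateFrom_countableGeneratingSet]

/-- Predictive distributions that are probability measures are versions of the regular conditional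
distributions. -/
lemma HasPredictives.condDistrib_ae_eq [StandardBorelSpace S] [Nonempty S]
    {X : ℕ → Ω → S} {α : ℕ → Ω → Measure S} (hα : HasPredictives P X α)
    (hX : ∀ n, Measurable (X n)) (n : ℕ) (hp : ∀ ω, IsProbabilityMeasure (α n ω)) :
    ∀ᵐ ω ∂P, condDistrib (X n) (fun ω (i : Fin n) => X i ω) P (fun i => X i ω) = α n ω := by
  have hH : Measurable (fun ω (i : Fin n) => X i ω) := measurable_pi_lambda _ fun i => hX i
  obtain ⟨C, hC, hpi, hgen⟩ := exists_countable_piSystem S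
  have hmeas : ∀ A ∈ C, MeasurableSet A := fun A hA => by
    rw [← hgen]; exact MeasurableSpace.measurableSet_generateFrom hA
  have : ∀ᵐ ω ∂P, ∀ A ∈ C,
      (condDistrib (X n) (fun ω (i : Fin n) => X i ω) P (fun i => X i ω)).real A
        = (α n ω).real A := by
    rw [ae_ball_iff hC]
    intro A hA
    filter_upwards [hα n A (hmeas A hA), condDistrib_ae_eq_condExp (μ := P) hH (hX n) (hmeas A hA)]
      with ω h1 h2
    rw [h2, h1]
  filter_upwards [this] with ω hω
  have := hp ω
  refine ext_of_generate_finite C hgen.symm hpi (fun A hA => ?_) (by simp)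
  exact (measureReal_eq_measureReal_iff (measure_ne_top _ _) (measure_ne_top _ _)).1 (hω A hA)

lemma ae_mem_of_condDistrib {T : Type*} [MeasurableSpace T] [StandardBorelSpace S] [Nonempty S]
    {H : Ω → T} {Y : Ω → S} {κ : Ω → Measure S} (hH : Measurable H) (hY : Measurable Y)
    (hκ : ∀ᵐ ω ∂P, condDistrib Y H P (H ω) = κ ω)
    {B : Set (T × S)} (hB : MeasurableSet B)
    (h : ∀ᵐ ω ∂P, ∀ᵐ y ∂(κ ω), (H ω, y) ∈ B) : ∀ᵐ ω ∂P, (H ω, Y ω) ∈ B := by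
  have h0 : P.map (fun ω => (H ω, Y ω)) Bᶜ = 0 := by
    rw [← compProd_map_condDistrib hY.aemeasurable, Measure.compProd_apply hB.compl,
      lintegral_map (Kernel.measurable_kernel_prodMk_left hB.compl) hH]
    refine lintegral_eq_zero_of_ae_eq_zero ?_
    filter_upwards [h, hκ] with ω h hω
    rw [hω]
    exact h
  rwa [Measure.map_apply (hH.prodMk hY) hB.compl] at h0

/-- If the image of the conditional law does not depend on the conditioning value, disintegration
makes the joint law a product; this is checked on rectangles. -/
lemma indepFun_of_condDistrib {T R : Type*} [MeasurableSpace T] [MeasurableSpace R]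
    [StandardBorelSpace S] [Nonempty S]
    {H : Ω → T} {Y : Ω → S} {κ : Ω → Measure S} (hH : Measurable H) (hY : Measurable Y)
    (hκ : ∀ᵐ ω ∂P, condDistrib Y H P (H ω) = κ ω)
    {G : T × S → R} (hG : Measurable G) (ν : Measure R) [IsProbabilityMeasure ν]
    (h : ∀ᵐ ω ∂P, (κ ω).map (fun y => G (H ω, y)) = ν) :
    IndepFun H (fun ω => G (H ω, Y ω)) P ∧ P.map (fun ω => G (H ω, Y ω)) = ν := by
  have hHY : Measurable fun ω => (H ω, Y ω) := hH.prodMk hY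
  have hGHY : Measurable fun ω => G (H ω, Y ω) := hG.comp hHY
  have := Measure.isProbabilityMeasure_map (μ := P) hH.aemeasurable
  have key : P.map (fun ω => (H ω, G (H ω, Y ω))) = (P.map H).prod ν := by
    have hF : Measurable fun z : T × S => (z.1, G z) := measurable_fst.prodMk hG
    have e : (fun ω => (H ω, G (H ω, Y ω))) = (fun z : T × S => (z.1, G z)) ∘ fun ω => (H ω, Y ω) :=
      rfl
    rw [e, ← Measure.map_map hF hHY, ← compProd_map_condDistrib hY.aemeasurable]
    refine (Measure.prod_eq fun s t hs ht => ?_).symm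
    rw [Measure.map_apply hF (hs.prod ht), Measure.compProd_apply (hF (hs.prod ht)),
      lintegral_map (Kernel.measurable_kernel_prodMk_left (hF (hs.prod ht))) hH,
      Measure.map_apply hH hs, mul_comm, ← lintegral_indicator_const (hH hs)]
    refine lintegral_congr_ae ?_
    filter_upwards [h, hκ] with ω h1 h2
    rw [h2]
    by_cases hω : H ω ∈ s
    · have hm : Measurable fun y => G (H ω, y) := hG.comp measurable_prodMk_left
      rw [Set.indicator_of_mem (show ω ∈ H ⁻¹' s from hω), ← h1, Measure.map_apply hm ht]
      congr 1
      ext y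
      simp [hω]
    · rw [Set.indicator_of_notMem (show ω ∉ H ⁻¹' s from hω)]
      have he : Prod.mk (H ω) ⁻¹' ((fun z : T × S => (z.1, G z)) ⁻¹' s ×ˢ t) = ∅ := by
        ext y
        simp [hω]
      rw [he, measure_empty]
  have h2 : P.map (fun ω => G (H ω, Y ω)) = ν := by
    have e : (fun ω => G (H ω, Y ω)) = Prod.snd ∘ (fun ω => (H ω, G (H ω, Y ω))) := rfl
    rw [e, ← Measure.map_map measurable_snd (hH.prodMk hGHY), key,
      Measure.map_snd_prod, measure_univ, one_smul]
  refine ⟨?_, h2⟩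
  rw [indepFun_iff_map_prod_eq_prod_map_map hH.aemeasurable hGHY.aemeasurable, h2, key]

end ConditionalLaw

/-! ### Recursions for the mean and variance of a real sequence -/

section RealSequences

/-- The mean of the first `n` terms of a real sequence. -/
def seqMean (t : ℕ → ℝ) (n : ℕ) : ℝ := (n : ℝ)⁻¹ * ∑ i ∈ Finset.range n, t i

/-- The empirical variance of the first `n` terms of a real sequence. -/
def seqVar (t : ℕ → ℝ) (n : ℕ) : ℝ := (n : ℝ)⁻¹ * ∑ i ∈ Finset.range n, (t i - seqMean t n) ^ 2

lemma seqMean_succ (t : ℕ → ℝ) (n : ℕ) :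
    seqMean t (n + 1) = seqMean t n + (t n - seqMean t n) / (n + 1) := by
  -- For n = 0 the mean is 0, as an empty sum, and the recursion still holds.
  rcases eq_or_ne n 0 with rfl | hn
  · simp [seqMean]
  have : (n : ℝ) ≠ 0 := by exact_mod_cast hn
  simp only [seqMean, Finset.sum_range_succ, Nat.cast_add, Nat.cast_one]
  field_simp
  ring

lemma seqVar_eq (t : ℕ → ℝ) {n : ℕ} (hn : n ≠ 0) :
    seqVar t n = (n : ℝ)⁻¹ * ∑ i ∈ Finset.range n, t i ^ 2 - seqMean t n ^ 2 := by
  have h0 : (n : ℝ) ≠ 0 := by exact_mod_cast hn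
  have hS : ∑ i ∈ Finset.range n, t i = n * seqMean t n := by
    rw [seqMean]; field_simp
  have : ∑ i ∈ Finset.range n, (t i - seqMean t n) ^ 2
      = ∑ i ∈ Finset.range n, t i ^ 2 - n * seqMean t n ^ 2 := by
    simp only [sub_sq, Finset.sum_add_distrib, Finset.sum_sub_distrib, ← Finset.mul_sum,
      ← Finset.sum_mul, hS, Finset.sum_const, Finset.card_range, nsmul_eq_mul]
    ring
  rw [seqVar, this]
  field_simp

lemma seqVar_succ (t : ℕ → ℝ) {n : ℕ} (hn : n ≠ 0) :
    seqVar t (n + 1) =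
      n / (n + 1) * seqVar t n + n / (n + 1) ^ 2 * (t n - seqMean t n) ^ 2 := by
  have h0 : (n : ℝ) ≠ 0 := by exact_mod_cast hn
  rw [seqVar_eq t hn, seqVar_eq t n.succ_ne_zero, seqMean_succ, Finset.sum_range_succ]
  push_cast
  field_simp
  ring

lemma seqVar_nonneg (t : ℕ → ℝ) (n : ℕ) : 0 ≤ seqVar t n :=
  mul_nonneg (by positivity) (Finset.sum_nonneg fun _ _ => sq_nonneg _)

/-- Two distinct terms cannot both equal the mean, so one square is positive. -/
lemma seqVar_pos {t : ℕ → ℝ} (ht : t 0 ≠ t 1) {n : ℕ} (hn : 2 ≤ n) : 0 < seqVar t n := by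
  have hn' : (0 : ℝ) < n := by exact_mod_cast (by omega : 0 < n)
  refine mul_pos (inv_pos.2 hn') ?_
  by_cases h : t 0 = seqMean t n
  · refine Finset.sum_pos' (fun _ _ => sq_nonneg _) ⟨1, Finset.mem_range.2 (by omega), ?_⟩
    have : t 1 - seqMean t n ≠ 0 := sub_ne_zero.2 (h ▸ ht.symm)
    positivity
  · refine Finset.sum_pos' (fun _ _ => sq_nonneg _) ⟨0, Finset.mem_range.2 (by omega), ?_⟩
    have : t 0 - seqMean t n ≠ 0 := sub_ne_zero.2 h
    positivity

end RealSequences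

/-! ### Gaussian laws and observations on a line -/

section Line

variable {p : ℕ} {Ω : Type*}

lemma sampleMean_of_line {X : ℕ → Ω → EuclideanSpace ℝ (Fin p)} {ω : Ω}
    {x v : EuclideanSpace ℝ (Fin p)} {t : ℕ → ℝ} {n : ℕ}
    (hn : n ≠ 0) (h : ∀ i < n, X i ω = x + t i • v) :
    sampleMean X n ω = x + seqMean t n • v := by
  have h0 : (n : ℝ) ≠ 0 := by exact_mod_cast hn
  rw [sampleMean, Finset.sum_congr rfl fun i hi => h i (Finset.mem_range.1 hi),
    Finset.sum_add_distrib, Finset.sum_const, Finset.card_range, ← Finset.sum_smul, smul_add,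
    ← Nat.cast_smul_eq_nsmul ℝ, smul_smul, smul_smul, inv_mul_cancel₀ h0, one_smul, seqMean]

lemma sampleCov_of_line {X : ℕ → Ω → EuclideanSpace ℝ (Fin p)} {ω : Ω}
    {x v : EuclideanSpace ℝ (Fin p)} {t : ℕ → ℝ} {n : ℕ}
    (hn : n ≠ 0) (h : ∀ i < n, X i ω = x + t i • v) :
    sampleCov X n ω = seqVar t n • Matrix.vecMulVec v.ofLp v.ofLp := by
  rw [sampleCov, seqVar, Finset.mul_sum, Finset.sum_smul, Finset.smul_sum]
  refine Finset.sum_congr rfl fun i hi => ?_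
  have : X i ω - sampleMean X n ω = (t i - seqMean t n) • v := by
    rw [h i (Finset.mem_range.1 hi), sampleMean_of_line hn h, sub_smul]
    abel
  rw [this, WithLp.ofLp_smul, Matrix.smul_vecMulVec, Matrix.vecMulVec_smul, smul_smul, smul_smul]
  congr 1
  ring

lemma posSemidef_smul_vecMulVec (q : NNReal) (v : Fin p → ℝ) :
    ((q : ℝ) • Matrix.vecMulVec v v).PosSemidef := by
  have := (Matrix.posSemidef_vecMulVec_self_star v).smul q.coe_nonneg
  simpa using this

/-- A Gaussian distribution with covariance of rank at most one is carried by a line. -/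
lemma multivariateGaussian_line (x v : EuclideanSpace ℝ (Fin p)) (m : ℝ) (q : NNReal) :
    multivariateGaussian (x + m • v) ((q : ℝ) • Matrix.vecMulVec v.ofLp v.ofLp)
      = (gaussianReal m q).map fun t => x + t • v := by
  have hf : Measurable fun t : ℝ => x + t • v := by fun_prop
  have := Measure.isProbabilityMeasure_map (μ := gaussianReal m q) hf.aemeasurable
  -- Characteristic functions also cover the degenerate laws, which have no density.
  refine Measure.ext_of_charFun ?_
  ext y
  have hq : y.ofLp ⬝ᵥ Matrix.mulVec ((q : ℝ) • Matrix.vecMulVec v.ofLp v.ofLp) y.ofLp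
      = q * inner ℝ v y ^ 2 := by
    rw [Matrix.smul_mulVec, Matrix.vecMulVec_mulVec, EuclideanSpace.inner_eq_star_dotProduct]
    simp [dotProduct_comm v.ofLp y.ofLp]
    exact Or.inl (by ring)
  rw [charFun_multivariateGaussian (posSemidef_smul_vecMulVec q v.ofLp), hq, charFun_apply,
    integral_map hf.aemeasurable (by fun_prop)]
  have e : ∀ t : ℝ, Complex.exp (inner ℝ (x + t • v) y * Complex.I)
      = Complex.exp (inner ℝ x y * Complex.I) *
        Complex.exp ((inner ℝ t (inner ℝ v y) : ℝ) * Complex.I) := fun t => by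
    rw [← Complex.exp_add, inner_add_left, inner_smul_left]
    congr 1
    simp
    ring
  simp only [e]
  rw [integral_const_mul, ← charFun_apply, charFun_gaussianReal, ← Complex.exp_add,
    real_inner_comm, inner_add_left, inner_smul_left]
  congr 1
  push_cast
  simp
  ring

/-- The coordinate of `z` along the line through `x` and `y`, with origin `x` and unit `y - x`. -/
def lineCoord (x y z : EuclideanSpace ℝ (Fin p)) : ℝ := inner ℝ (z - x) (y - x) / ‖y - x‖ ^ 2

lemma measurable_lineCoord {α : Type*} [MeasurableSpace α]
    {f g h : α → EuclideanSpace ℝ (Fin p)} (hf : Measurable f) (hg : Measurable g)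
    (hh : Measurable h) : Measurable fun a => lineCoord (f a) (g a) (h a) := by
  unfold lineCoord
  fun_prop

lemma lineCoord_self (x y : EuclideanSpace ℝ (Fin p)) : lineCoord x y x = 0 := by
  simp [lineCoord]

lemma lineCoord_add_smul {x y : EuclideanSpace ℝ (Fin p)} (h : y ≠ x) (t : ℝ) :
    lineCoord x y (x + t • (y - x)) = t := by
  have : ‖y - x‖ ≠ 0 := norm_ne_zero_iff.2 (sub_ne_zero.2 h)
  rw [lineCoord, add_sub_cancel_left, inner_smul_left, real_inner_self_eq_norm_sq]
  simp
  field_simp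

lemma lineCoord_right {x y : EuclideanSpace ℝ (Fin p)} (h : y ≠ x) : lineCoord x y y = 1 := by
  have := lineCoord_add_smul h 1
  rwa [one_smul, add_sub_cancel] at this

end Line

/-! ### Conditional laws through statistics of the past -/

section ConditionalLaw

variable {Ω S : Type*} [MeasurableSpace Ω] [MeasurableSpace S] {P : Measure Ω}
  [IsProbabilityMeasure P]

/-- By Doob–Dynkin a past-measurable statistic factors through the history, so it need not be
written as an explicit function of it. -/
lemma ae_mem_of_condDistrib_comap {T R : Type*} [MeasurableSpace T] [StandardBorelSpace S]
    [Nonempty S] [MeasurableSpace R] [StandardBorelSpace R] [Nonempty R]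
    {H : Ω → T} {Y : Ω → S} {κ : Ω → Measure S} (hH : Measurable H) (hY : Measurable Y)
    (hκ : ∀ᵐ ω ∂P, condDistrib Y H P (H ω) = κ ω)
    {g : Ω → R} (hg : Measurable[MeasurableSpace.comap H inferInstance] g)
    {B : Set (R × S)} (hB : MeasurableSet B)
    (h : ∀ᵐ ω ∂P, ∀ᵐ y ∂(κ ω), (g ω, y) ∈ B) : ∀ᵐ ω ∂P, (g ω, Y ω) ∈ B := by
  obtain ⟨f, hf, rfl⟩ := hg.exists_eq_measurable_comp
  have hB' : MeasurableSet ((fun z : T × S => (f z.1, z.2)) ⁻¹' B) :=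
    ((hf.comp measurable_fst).prodMk measurable_snd) hB
  exact ae_mem_of_condDistrib hH hY hκ hB' h

lemma indep_of_condDistrib_comap {T R U : Type*} [MeasurableSpace T] [StandardBorelSpace S]
    [Nonempty S] [MeasurableSpace R] [StandardBorelSpace R] [Nonempty R] [MeasurableSpace U]
    {H : Ω → T} {Y : Ω → S} {κ : Ω → Measure S} (hH : Measurable H) (hY : Measurable Y)
    (hκ : ∀ᵐ ω ∂P, condDistrib Y H P (H ω) = κ ω)
    {g : Ω → R} (hg : Measurable[MeasurableSpace.comap H inferInstance] g)
    {G : R × S → U} (hG : Measurable G) (ν : Measure U) [IsProbabilityMeasure ν]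
    (h : ∀ᵐ ω ∂P, (κ ω).map (fun y => G (g ω, y)) = ν) :
    Indep (MeasurableSpace.comap H inferInstance)
      (MeasurableSpace.comap (fun ω => G (g ω, Y ω)) inferInstance) P ∧
      P.map (fun ω => G (g ω, Y ω)) = ν := by
  obtain ⟨f, hf, rfl⟩ := hg.exists_eq_measurable_comp
  have hG' : Measurable (fun z : T × S => G (f z.1, z.2)) :=
    hG.comp ((hf.comp measurable_fst).prodMk measurable_snd)
  have := indepFun_of_condDistrib hH hY hκ hG' ν h
  exact ⟨this.1, this.2⟩

end ConditionalLaw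

/-! ### Reduction to the line and Gaussian innovations -/

section GaussianPredictive

variable {p : ℕ} {Ω : Type*}

local notation "E" => EuclideanSpace ℝ (Fin p)

instance (X : ℕ → Ω → EuclideanSpace ℝ (Fin p)) (n : ℕ) (ω : Ω) :
    IsProbabilityMeasure (gaussianPredictive X n ω) := by
  unfold gaussianPredictive
  split <;> infer_instance

/-- One coordinate suffices: its marginal has variance 1, hence no atoms. This is where p ≥ 1
enters. -/
lemma multivariateGaussian_one_singleton (hp : 1 ≤ p) (x y : EuclideanSpace ℝ (Fin p)) :
    multivariateGaussian x 1 {y} = 0 := by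
  have hmp := measurePreserving_eval_multivariateGaussian (μ := x)
    (Matrix.PosSemidef.one (n := Fin p) (R := ℝ)) (i := ⟨0, hp⟩)
  have := nullSingletonClass_gaussianReal (μ := x ⟨0, hp⟩)
    (v := ((1 : Matrix (Fin p) (Fin p) ℝ) ⟨0, hp⟩ ⟨0, hp⟩).toNNReal) (by simp)
  refine measure_mono_null (t := (fun z : E => z ⟨0, hp⟩) ⁻¹' {y ⟨0, hp⟩}) (by simp) ?_
  rw [hmp.measure_preimage (measurableSet_singleton _).nullMeasurableSet, measure_singleton]

/-- The coordinates of the observations along the line through the first two of them. -/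
def obsCoord (X : ℕ → Ω → EuclideanSpace ℝ (Fin p)) (ω : Ω) (i : ℕ) : ℝ :=
  lineCoord (X 0 ω) (X 1 ω) (X i ω)

/-- The standardized innovations of the coordinates of the observations. -/
def innovation (X : ℕ → Ω → EuclideanSpace ℝ (Fin p)) (k : ℕ) (ω : Ω) : ℝ :=
  (obsCoord X ω (k + 2) - seqMean (obsCoord X ω) (k + 2)) / √(seqVar (obsCoord X ω) (k + 2))

lemma gaussianPredictive_of_line {X : ℕ → Ω → EuclideanSpace ℝ (Fin p)} {ω : Ω} {k : ℕ}
    (h : ∀ i < k + 2, X i ω = X 0 ω + obsCoord X ω i • (X 1 ω - X 0 ω)) :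
    gaussianPredictive X (k + 2) ω =
      (gaussianReal (seqMean (obsCoord X ω) (k + 2)) (seqVar (obsCoord X ω) (k + 2)).toNNReal).map
        fun t => X 0 ω + t • (X 1 ω - X 0 ω) := by
  rw [← multivariateGaussian_line, gaussianPredictive, sampleMean_of_line (by omega) h,
    sampleCov_of_line (by omega) h, Real.coe_toNNReal _ (seqVar_nonneg _ _)]

lemma measurable_obs_comap (X : ℕ → Ω → EuclideanSpace ℝ (Fin p)) {n i : ℕ} (hi : i < n) :
    Measurable[MeasurableSpace.comap (fun ω (i : Fin n) => X i ω) inferInstance] (X i) :=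
  (measurable_pi_apply (⟨i, hi⟩ : Fin n)).comp (comap_measurable fun ω (i : Fin n) => X i ω)

lemma measurable_history [MeasurableSpace Ω] {X : ℕ → Ω → EuclideanSpace ℝ (Fin p)}
    (hX : ∀ n, Measurable (X n)) (n : ℕ) : Measurable fun ω (i : Fin n) => X i ω :=
  measurable_pi_lambda _ fun i => hX i

lemma seqVar_obsCoord_pos {X : ℕ → Ω → EuclideanSpace ℝ (Fin p)} {ω : Ω}
    (h : X 1 ω ≠ X 0 ω) {n : ℕ} (hn : 2 ≤ n) :
    0 < seqVar (obsCoord X ω) n :=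
  seqVar_pos (by simp [obsCoord, lineCoord_self, lineCoord_right h]) hn

section Measurability

variable {m : MeasurableSpace Ω} {X : ℕ → Ω → EuclideanSpace ℝ (Fin p)} {n : ℕ}

lemma measurable_obsCoord (h0 : Measurable[m] (X 0)) (h1 : Measurable[m] (X 1)) {i : ℕ}
    (hi : Measurable[m] (X i)) : Measurable[m] fun ω => obsCoord X ω i :=
  measurable_lineCoord h0 h1 hi

lemma measurable_seqMean_obsCoord (hn : 2 ≤ n) (h : ∀ i < n, Measurable[m] (X i)) :
    Measurable[m] fun ω => seqMean (obsCoord X ω) n := by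
  unfold seqMean
  refine Measurable.const_mul (Finset.measurable_fun_sum _ fun i hi => ?_) _
  exact measurable_obsCoord (h 0 (by omega)) (h 1 (by omega)) (h i (Finset.mem_range.1 hi))

lemma measurable_seqVar_obsCoord (hn : 2 ≤ n) (h : ∀ i < n, Measurable[m] (X i)) :
    Measurable[m] fun ω => seqVar (obsCoord X ω) n := by
  unfold seqVar
  refine Measurable.const_mul (Finset.measurable_fun_sum _ fun i hi => ?_) _
  exact ((measurable_obsCoord (h 0 (by omega)) (h 1 (by omega))
    (h i (Finset.mem_range.1 hi))).sub (measurable_seqMean_obsCoord hn h)).pow_const 2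

lemma measurable_innovation {k : ℕ} (h : ∀ i < k + 3, Measurable[m] (X i)) :
    Measurable[m] (innovation X k) := by
  have h' : ∀ i < k + 2, Measurable[m] (X i) := fun i hi => h i (by omega)
  exact ((measurable_obsCoord (h 0 (by omega)) (h 1 (by omega)) (h (k + 2) (by omega))).sub
    (measurable_seqMean_obsCoord (by omega) h')).div
      (measurable_seqVar_obsCoord (by omega) h').sqrt

end Measurability

variable [mΩ : MeasurableSpace Ω]

/-- The filtration generated by the observations, started at the second of them. -/
def obsFiltration {X : ℕ → Ω → EuclideanSpace ℝ (Fin p)} (hX : ∀ n, Measurable (X n)) :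
    Filtration ℕ mΩ where
  -- Time 0 already contains `X 0` and `X 1`, which fix the line and the coordinate.
  seq k := MeasurableSpace.comap (fun ω (i : Fin (k + 2)) => X i ω) inferInstance
  mono' k l hkl := by
    refine Measurable.comap_le ?_
    refine @measurable_pi_lambda _ _ _ (_) _ _ fun i => ?_
    exact measurable_obs_comap X (by omega)
  le' k := (measurable_history hX (k + 2)).comap_le

section Predictive

variable {P : Measure Ω} [IsProbabilityMeasure P] {X : ℕ → Ω → EuclideanSpace ℝ (Fin p)}

lemma ae_obs_one_ne_obs_zero (hp : 1 ≤ p) (hX : ∀ n, Measurable (X n))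
    (hα : HasPredictives P X (gaussianPredictive X)) : ∀ᵐ ω ∂P, X 1 ω ≠ X 0 ω := by
  have hB : MeasurableSet {z : E × E | z.2 ≠ z.1} :=
    (measurableSet_eq_fun measurable_snd measurable_fst).compl
  refine ae_mem_of_condDistrib_comap (measurable_history hX 1) (hX 1)
    (hα.condDistrib_ae_eq hX 1 fun ω => inferInstance)
    (measurable_obs_comap X (by omega : 0 < 1)) hB ?_
  filter_upwards with ω
  have := multivariateGaussian_one_singleton hp (X 0 ω) (X 0 ω)
  rw [measure_eq_zero_iff_ae_notMem] at this
  exact this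

/-- Strong induction: while the past lies on the line, the empirical covariance has rank at most
one, and the predictive law is carried by the same line. -/
lemma ae_obs_mem_line (hp : 1 ≤ p) (hX : ∀ n, Measurable (X n))
    (hα : HasPredictives P X (gaussianPredictive X)) (n : ℕ) :
    ∀ᵐ ω ∂P, X n ω = X 0 ω + obsCoord X ω n • (X 1 ω - X 0 ω) := by
  induction n using Nat.strong_induction_on with
  | _ n ih =>
    match n with
    | 0 => exact Eventually.of_forall fun ω => by simp [obsCoord, lineCoord_self]
    | 1 =>
      filter_upwards [ae_obs_one_ne_obs_zero hp hX hα] with ω h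
      simp [obsCoord, lineCoord_right h]
    | k + 2 =>
      have hF : Measurable fun z : (E × E) × E =>
          z.1.1 + lineCoord z.1.1 z.1.2 z.2 • (z.1.2 - z.1.1) := by
        have : Measurable fun z : (E × E) × E => lineCoord z.1.1 z.1.2 z.2 :=
          measurable_lineCoord measurable_fst.fst measurable_fst.snd measurable_snd
        fun_prop
      refine ae_mem_of_condDistrib_comap (measurable_history hX (k + 2)) (hX (k + 2))
        (hα.condDistrib_ae_eq hX (k + 2) fun ω => inferInstance)
        (g := fun ω => (X 0 ω, X 1 ω))
        ((measurable_obs_comap X (by omega)).prodMk (measurable_obs_comap X (by omega)))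
        (measurableSet_eq_fun measurable_snd hF) ?_
      have ih' : ∀ᵐ ω ∂P, ∀ i < k + 2, X i ω = X 0 ω + obsCoord X ω i • (X 1 ω - X 0 ω) := by
        rw [ae_all_iff]
        intro i
        by_cases hi : i < k + 2
        · filter_upwards [ih i hi] with ω h _ using h
        · exact Eventually.of_forall fun ω h => absurd h hi
      filter_upwards [ih', ae_obs_one_ne_obs_zero hp hX hα] with ω h hne
      have hm : Measurable fun y => lineCoord (X 0 ω) (X 1 ω) y :=
        measurable_lineCoord measurable_const measurable_const measurable_id
      have hS : MeasurableSet
          {y | y = X 0 ω + lineCoord (X 0 ω) (X 1 ω) y • (X 1 ω - X 0 ω)} :=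
        measurableSet_eq_fun measurable_id (by fun_prop)
      have hf : Measurable fun t : ℝ => X 0 ω + t • (X 1 ω - X 0 ω) := by fun_prop
      rw [gaussianPredictive_of_line h]
      refine (ae_map_iff hf.aemeasurable hS).2 (Eventually.of_forall fun t => ?_)
      simp only [lineCoord_add_smul hne]

lemma ae_forall_obs_mem_line (hp : 1 ≤ p) (hX : ∀ n, Measurable (X n))
    (hα : HasPredictives P X (gaussianPredictive X)) :
    ∀ᵐ ω ∂P, X 1 ω ≠ X 0 ω ∧ ∀ n, X n ω = X 0 ω + obsCoord X ω n • (X 1 ω - X 0 ω) := by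
  filter_upwards [ae_obs_one_ne_obs_zero hp hX hα, ae_all_iff.2 (ae_obs_mem_line hp hX hα)]
    with ω h1 h2 using ⟨h1, h2⟩

lemma map_standardize_gaussianReal (m : ℝ) {q : ℝ} (hq : 0 < q) :
    (gaussianReal m q.toNNReal).map (fun t => (t - m) / √q) = gaussianReal 0 1 := by
  have e : (fun t => (t - m) / √q) = (fun t => t / √q) ∘ fun t => t - m := rfl
  rw [e, ← Measure.map_map (by fun_prop) (by fun_prop), gaussianReal_map_sub_const,
    gaussianReal_map_div_const]
  congr 1
  · simp
  · ext
    simp [Real.sq_sqrt hq.le, Real.coe_toNNReal _ hq.le, hq.ne']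

/-- The standardized innovations are standard Gaussian and independent of the past. -/
lemma innovation_indep_law (hp : 1 ≤ p) (hX : ∀ n, Measurable (X n))
    (hα : HasPredictives P X (gaussianPredictive X)) (k : ℕ) :
    Indep (obsFiltration hX k) (MeasurableSpace.comap (innovation X k) inferInstance) P ∧
      P.map (innovation X k) = gaussianReal 0 1 := by
  have hF : Measurable fun z : (E × E × ℝ × ℝ) × E =>
      (lineCoord z.1.1 z.1.2.1 z.2 - z.1.2.2.1) / √ z.1.2.2.2 := by
    have : Measurable fun z : (E × E × ℝ × ℝ) × E => lineCoord z.1.1 z.1.2.1 z.2 :=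
      measurable_lineCoord measurable_fst.fst measurable_fst.snd.fst measurable_snd
    fun_prop
  refine indep_of_condDistrib_comap (measurable_history hX (k + 2)) (hX (k + 2))
    (hα.condDistrib_ae_eq hX (k + 2) fun ω => inferInstance)
    -- These four statistics are all of the past that the standardization uses.
    (g := fun ω => (X 0 ω, X 1 ω, seqMean (obsCoord X ω) (k + 2), seqVar (obsCoord X ω) (k + 2)))
    ((measurable_obs_comap X (by omega)).prodMk ((measurable_obs_comap X (by omega)).prodMk
      ((measurable_seqMean_obsCoord (by omega) fun i hi => measurable_obs_comap X hi).prodMk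
        (measurable_seqVar_obsCoord (by omega) fun i hi => measurable_obs_comap X hi))))
    hF (gaussianReal 0 1) ?_
  filter_upwards [ae_forall_obs_mem_line hp hX hα] with ω hω
  have hm : Measurable fun y => lineCoord (X 0 ω) (X 1 ω) y :=
    measurable_lineCoord measurable_const measurable_const measurable_id
  rw [gaussianPredictive_of_line fun i _ => hω.2 i,
    ← map_standardize_gaussianReal (seqMean (obsCoord X ω) (k + 2))
      (seqVar_obsCoord_pos hω.1 (by omega : 2 ≤ k + 2)),
    Measure.map_map (by fun_prop) (by fun_prop)]
  congr 1
  ext t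
  simp [lineCoord_add_smul hω.1]

end Predictive

end GaussianPredictive

/-! ### Martingales with steps of order 1/k -/

section MartingaleTransform

variable {Ω : Type*} [mΩ : MeasurableSpace Ω]

/-- The process `w` is driven by centered square integrable innovations `ζ` independent of the past,
with predictable coefficients `a` bounded in `L²`, and steps decreasing like `1 / k`. -/
structure IsDampedWalk (P : Measure Ω) (ℱ : Filtration ℕ mΩ) (w a ζ : ℕ → Ω → ℝ) (C D : ℝ) :
    Prop where
  measurable_zero : Measurable[ℱ 0] (w 0)
  memLp_zero : MemLp (w 0) 2 P
  measurable_coeff : ∀ k, Measurable[ℱ k] (a k)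
  memLp_coeff : ∀ k, MemLp (a k) 2 P
  integral_coeff_sq_le : ∀ k, ∫ ω, a k ω ^ 2 ∂P ≤ C
  measurable_innov : ∀ k, Measurable[ℱ (k + 1)] (ζ k)
  memLp_innov : ∀ k, MemLp (ζ k) 2 P
  integral_innov : ∀ k, ∫ ω, ζ k ω ∂P = 0
  integral_innov_sq_le : ∀ k, ∫ ω, ζ k ω ^ 2 ∂P ≤ D
  indep : ∀ k, Indep (ℱ k) (MeasurableSpace.comap (ζ k) inferInstance) P
  succ : ∀ k ω, w (k + 1) ω = w k ω + a k ω * ζ k ω / (k + 1)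

variable {P : Measure Ω}

lemma indepFun_of_measurable {m : MeasurableSpace Ω} {f g : Ω → ℝ} (hf : Measurable[m] f)
    (h : Indep m (MeasurableSpace.comap g inferInstance) P) : IndepFun f g P :=
  (IndepFun_iff_Indep _ _ _).2 (indep_of_indep_of_le_left h hf.comap_le)

/-- Independence keeps the product in L², where Hölder alone would give only L¹. -/
lemma memLp_two_mul_of_indepFun {f g : Ω → ℝ} (hf : MemLp f 2 P) (hg : MemLp g 2 P)
    (h : IndepFun f g P) : MemLp (fun ω => f ω * g ω) 2 P := by
  refine (memLp_two_iff_integrable_sq (hf.1.mul hg.1)).2 ?_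
  have h2 : IndepFun (fun ω => f ω ^ 2) (fun ω => g ω ^ 2) P :=
    h.comp (φ := fun x => x ^ 2) (ψ := fun x => x ^ 2) (by fun_prop) (by fun_prop)
  refine (h2.integrable_mul hf.integrable_sq hg.integrable_sq).congr
    (Eventually.of_forall fun ω => ?_)
  simp [mul_pow]

lemma integral_mul_sq_of_indepFun {f g : Ω → ℝ} (hf : MemLp f 2 P) (hg : MemLp g 2 P)
    (h : IndepFun f g P) :
    ∫ ω, (f ω * g ω) ^ 2 ∂P = (∫ ω, f ω ^ 2 ∂P) * ∫ ω, g ω ^ 2 ∂P := by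
  have h2 : IndepFun (fun ω => f ω ^ 2) (fun ω => g ω ^ 2) P :=
    h.comp (φ := fun x => x ^ 2) (ψ := fun x => x ^ 2) (by fun_prop) (by fun_prop)
  simp only [mul_pow]
  exact h2.integral_fun_mul_eq_mul_integral (hf.1.pow 2) (hg.1.pow 2)

namespace IsDampedWalk

variable {ℱ : Filtration ℕ mΩ} {w a ζ : ℕ → Ω → ℝ} {C D : ℝ}

lemma measurable (h : IsDampedWalk P ℱ w a ζ C D) (k : ℕ) : Measurable[ℱ k] (w k) := by
  induction k with
  | zero => exact h.measurable_zero
  | succ k ih =>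
    rw [funext (h.succ k)]
    exact (ih.mono (ℱ.mono k.le_succ) le_rfl).add
      ((((h.measurable_coeff k).mono (ℱ.mono k.le_succ) le_rfl).mul
        (h.measurable_innov k)).div_const _)

lemma memLp_step (h : IsDampedWalk P ℱ w a ζ C D) (k : ℕ) :
    MemLp (fun ω => a k ω * ζ k ω / (k + 1)) 2 P := by
  have := (memLp_two_mul_of_indepFun (h.memLp_coeff k) (h.memLp_innov k)
    (indepFun_of_measurable (h.measurable_coeff k) (h.indep k))).mul_const ((k + 1 : ℝ)⁻¹)
  simpa only [div_eq_mul_inv] using this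

lemma memLp (h : IsDampedWalk P ℱ w a ζ C D) (k : ℕ) : MemLp (w k) 2 P := by
  induction k with
  | zero => exact h.memLp_zero
  | succ k ih =>
    rw [funext (h.succ k)]
    exact ih.add (h.memLp_step k)

lemma nonneg (h : IsDampedWalk P ℱ w a ζ C D) : 0 ≤ C ∧ 0 ≤ D :=
  ⟨(integral_nonneg fun _ => sq_nonneg _).trans (h.integral_coeff_sq_le 0),
    (integral_nonneg fun _ => sq_nonneg _).trans (h.integral_innov_sq_le 0)⟩

/-- The cross term vanishes, since the innovation is centered and independent of everything else in
it. -/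
lemma integral_sub_sq_succ_le (h : IsDampedWalk P ℱ w a ζ C D) {n k : ℕ} (hnk : n ≤ k) :
    ∫ ω, (w (k + 1) ω - w n ω) ^ 2 ∂P ≤
      ∫ ω, (w k ω - w n ω) ^ 2 ∂P + C * D / (k + 1) ^ 2 := by
  have hd : MemLp (fun ω => w k ω - w n ω) 2 P := (h.memLp k).sub (h.memLp n)
  have hs := h.memLp_step k
  have hdm : Measurable[ℱ k] fun ω => w k ω - w n ω :=
    (h.measurable k).sub ((h.measurable n).mono (ℱ.mono hnk) le_rfl)
  have e : ∀ ω, (w (k + 1) ω - w n ω) ^ 2 = (w k ω - w n ω) ^ 2 +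
      2 * ((w k ω - w n ω) * (a k ω * ζ k ω / (k + 1))) + (a k ω * ζ k ω / (k + 1)) ^ 2 := by
    intro ω
    rw [h.succ]
    ring
  have hcross : ∫ ω, (w k ω - w n ω) * (a k ω * ζ k ω / (k + 1)) ∂P = 0 := by
    have e2 : ∀ ω, (w k ω - w n ω) * (a k ω * ζ k ω / (k + 1))
        = ((w k ω - w n ω) * a k ω / (k + 1)) * ζ k ω := fun ω => by ring
    have hm : Measurable[ℱ k] fun ω => (w k ω - w n ω) * a k ω / (k + 1) :=
      (hdm.mul (h.measurable_coeff k)).div_const _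
    simp only [e2]
    rw [(indepFun_of_measurable hm (h.indep k)).integral_fun_mul_eq_mul_integral
      (hm.mono (ℱ.le k) le_rfl).aestronglyMeasurable (h.memLp_innov k).1, h.integral_innov k,
      mul_zero]
  have hsq : ∫ ω, (a k ω * ζ k ω / (k + 1)) ^ 2 ∂P ≤ C * D / (k + 1) ^ 2 := by
    simp only [div_pow]
    rw [integral_div, integral_mul_sq_of_indepFun (h.memLp_coeff k) (h.memLp_innov k)
      (indepFun_of_measurable (h.measurable_coeff k) (h.indep k))]
    gcongr
    · exact h.nonneg.1
    · exact h.integral_coeff_sq_le k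
    · exact h.integral_innov_sq_le k
  have hc : Integrable (fun ω => (w k ω - w n ω) * (a k ω * ζ k ω / (k + 1))) P :=
    hd.integrable_mul hs
  have hi : Integrable (fun ω => (w k ω - w n ω) ^ 2 +
      2 * ((w k ω - w n ω) * (a k ω * ζ k ω / (k + 1)))) P := hd.integrable_sq.add (hc.const_mul 2)
  simp only [e]
  rw [integral_add hi hs.integrable_sq,
    integral_add hd.integrable_sq (hc.const_mul 2), integral_const_mul, hcross]
  linarith

lemma integral_sub_sq_le (h : IsDampedWalk P ℱ w a ζ C D) {n N : ℕ} (hnN : n ≤ N) :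
    ∫ ω, (w N ω - w n ω) ^ 2 ∂P ≤ 2 * (C * D) / (n + 1) := by
  have hCD : 0 ≤ C * D := mul_nonneg h.nonneg.1 h.nonneg.2
  -- Subtracting the term in N makes the induction telescope: 1/(k+1)² ≤ 2/(k+1) - 2/(k+2), valid
  -- from k = 0 thanks to the factor 2.
  have key : ∫ ω, (w N ω - w n ω) ^ 2 ∂P ≤ 2 * (C * D) / (n + 1) - 2 * (C * D) / (N + 1) := by
    induction N, hnN using Nat.le_induction with
    | base => simp
    | succ k hk ih =>
      have h1 : C * D / (k + 1) ^ 2 ≤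
          2 * (C * D) / (k + 1) - 2 * (C * D) / ((k + 1 : ℕ) + 1) := by
        have : 2 * (C * D) / (k + 1) - 2 * (C * D) / ((k + 1 : ℕ) + 1) - C * D / (k + 1) ^ 2
            = C * D * (k / ((k + 1) ^ 2 * (k + 2))) := by
          push_cast
          field_simp
          ring
        rw [← sub_nonneg, this]
        positivity
      linarith [h.integral_sub_sq_succ_le hk]
  exact key.trans (sub_le_self _ (by positivity))

/-- Fatou's lemma, letting N tend to infinity in `integral_sub_sq_le`. -/
lemma lintegral_limit_sub_sq_le (h : IsDampedWalk P ℱ w a ζ C D) {W : Ω → ℝ}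
    (hW : ∀ᵐ ω ∂P, Tendsto (fun n => w n ω) atTop (𝓝 (W ω))) (n : ℕ) :
    ∫⁻ ω, ENNReal.ofReal ((W ω - w n ω) ^ 2) ∂P ≤
      ENNReal.ofReal (2 * (C * D) / (n + 1)) := by
  have hm : ∀ k, Measurable (w k) := fun k => (h.measurable k).mono (ℱ.le k) le_rfl
  calc ∫⁻ ω, ENNReal.ofReal ((W ω - w n ω) ^ 2) ∂P
      = ∫⁻ ω, liminf (fun N => ENNReal.ofReal ((w N ω - w n ω) ^ 2)) atTop ∂P := by
        refine lintegral_congr_ae ?_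
        filter_upwards [hW] with ω hω
        exact (ENNReal.tendsto_ofReal ((hω.sub_const _).pow 2)).liminf_eq.symm
    _ ≤ liminf (fun N => ∫⁻ ω, ENNReal.ofReal ((w N ω - w n ω) ^ 2) ∂P) atTop :=
        lintegral_liminf_le fun N => (((hm N).sub (hm n)).pow_const 2).ennreal_ofReal
    _ ≤ _ := by
        refine liminf_le_of_frequently_le' (Eventually.frequently ?_)
        filter_upwards [eventually_ge_atTop n] with N hN
        have hi : Integrable (fun ω => (w N ω - w n ω) ^ 2) P :=
          ((h.memLp N).sub (h.memLp n)).integrable_sq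
        rw [← ofReal_integral_eq_lintegral_ofReal hi
          (Eventually.of_forall fun ω => sq_nonneg _)]
        exact ENNReal.ofReal_le_ofReal (h.integral_sub_sq_le hN)

/-- A damped walk converges in probability faster than any rate `o(1 / √n)`. -/
lemma tendstoInMeasure (h : IsDampedWalk P ℱ w a ζ C D) {W : Ω → ℝ} (hWm : Measurable W)
    (hW : ∀ᵐ ω ∂P, Tendsto (fun n => w n ω) atTop (𝓝 (W ω))) {d : ℕ → ℝ}
    (hd : Tendsto (fun n => d n / √(n + 1)) atTop (𝓝 0)) :
    TendstoInMeasure P (fun n ω => d n * (W ω - w n ω)) atTop fun _ => 0 := by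
  have hm : ∀ k, Measurable (w k) := fun k => (h.measurable k).mono (ℱ.le k) le_rfl
  rw [tendstoInMeasure_iff_norm]
  intro ε hε
  -- This is the Chebyshev bound to be reached.
  have hlim : Tendsto (fun n : ℕ => ENNReal.ofReal
      ((d n / √(n + 1)) ^ 2 * (2 * (C * D)) / ε ^ 2)) atTop (𝓝 0) := by
    have := ENNReal.tendsto_ofReal (((hd.pow 2).mul_const (2 * (C * D))).div_const (ε ^ 2))
    simpa using this
  refine tendsto_of_tendsto_of_tendsto_of_le_of_le tendsto_const_nhds hlim (fun _ => zero_le)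
    fun n => ?_
  have hset : {ω | ε ≤ ‖d n * (W ω - w n ω) - 0‖} ⊆
      {ω | ENNReal.ofReal (ε ^ 2) ≤
        ENNReal.ofReal (d n ^ 2) * ENNReal.ofReal ((W ω - w n ω) ^ 2)} := by
    intro ω hω
    simp only [Set.mem_ofPred_eq, sub_zero, Real.norm_eq_abs] at hω ⊢
    rw [← ENNReal.ofReal_mul (sq_nonneg _), ← mul_pow, ← sq_abs (_ * _)]
    exact ENNReal.ofReal_le_ofReal (by gcongr)
  refine (measure_mono hset).trans ((meas_ge_le_lintegral_div
    (by fun_prop) (by simpa using hε.ne') ENNReal.ofReal_ne_top).trans ?_)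
  rw [lintegral_const_mul _ (by fun_prop)]
  calc _ ≤ ENNReal.ofReal (d n ^ 2) * ENNReal.ofReal (2 * (C * D) / (n + 1)) /
        ENNReal.ofReal (ε ^ 2) := by
        gcongr
        exact h.lintegral_limit_sub_sq_le hW n
    _ = _ := by
        rw [← ENNReal.ofReal_mul (sq_nonneg _), ← ENNReal.ofReal_div_of_pos (by positivity)]
        congr 1
        rw [div_pow, Real.sq_sqrt (by positivity)]
        ring

variable [IsProbabilityMeasure P]

lemma martingale (h : IsDampedWalk P ℱ w a ζ C D) : Martingale w ℱ P := by
  refine martingale_of_condExp_sub_eq_zero_nat (fun k => (h.measurable k).stronglyMeasurable)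
    (fun k => (h.memLp k).integrable (by norm_num)) fun k => ?_
  have e : w (k + 1) - w k = (fun ω => a k ω * (k + 1 : ℝ)⁻¹) * ζ k := by
    ext ω
    simp only [Pi.sub_apply, Pi.mul_apply, h.succ]
    ring
  rw [e]
  have hint : Integrable ((fun ω => a k ω * (k + 1 : ℝ)⁻¹) * ζ k) P := by
    refine ((h.memLp_step k).integrable (by norm_num)).congr (Eventually.of_forall fun ω => ?_)
    simp only [Pi.mul_apply]
    ring
  refine (condExp_mul_of_stronglyMeasurable_left
    ((h.measurable_coeff k).mul_const _).stronglyMeasurable hint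
    ((h.memLp_innov k).integrable (by norm_num))).trans ?_
  have hm : Measurable (ζ k) := (h.measurable_innov k).mono (ℱ.le _) le_rfl
  filter_upwards [condExp_indep_eq hm.comap_le (ℱ.le k)
    (comap_measurable (ζ k)).stronglyMeasurable (h.indep k).symm] with ω hω
  simp [hω, h.integral_innov k]

/-- A damped walk converges almost surely. -/
lemma exists_ae_tendsto (h : IsDampedWalk P ℱ w a ζ C D) :
    ∃ W : Ω → ℝ, Measurable W ∧ ∀ᵐ ω ∂P, Tendsto (fun n => w n ω) atTop (𝓝 (W ω)) := by
  have hi : ∀ n, Integrable (fun ω => w n ω) P := fun n => (h.memLp n).integrable (by norm_num)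
  refine measurable_limit_of_tendsto_metrizable_ae
    (fun n => ((h.measurable n).mono (ℱ.le n) le_rfl).aemeasurable)
    (h.martingale.submartingale.exists_ae_tendsto_of_bdd
      -- The L¹ bound comes from |w n| ≤ |w 0| + 1 + (w n - w 0)².
      (R := (∫ ω, |w 0 ω| ∂P + 1 + 2 * (C * D)).toNNReal) fun n => ?_)
  rw [eLpNorm_one_eq_lintegral_enorm, ← ofReal_integral_norm_eq_lintegral_enorm (hi n)]
  refine ENNReal.ofReal_le_ofReal ?_
  have hs : Integrable (fun ω => (w n ω - w 0 ω) ^ 2) P :=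
    ((h.memLp n).sub (h.memLp 0)).integrable_sq
  have h0 : Integrable (fun ω => |w 0 ω| + 1) P := (hi 0).abs.add (integrable_const _)
  calc ∫ ω, ‖w n ω‖ ∂P ≤ ∫ ω, (|w 0 ω| + 1 + (w n ω - w 0 ω) ^ 2) ∂P := by
        refine integral_mono (hi n).norm (h0.add hs) fun ω => ?_
        have h1 : |w n ω| ≤ |w 0 ω| + |w n ω - w 0 ω| := by
          have := abs_add_le (w 0 ω) (w n ω - w 0 ω)
          rwa [add_sub_cancel] at this
        have h2 : |w n ω - w 0 ω| ≤ 1 + (w n ω - w 0 ω) ^ 2 := by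
          rw [← sq_abs (w n ω - w 0 ω)]
          nlinarith [sq_nonneg (|w n ω - w 0 ω| - 1)]
        simp only [Real.norm_eq_abs]
        linarith
    _ = ∫ ω, |w 0 ω| ∂P + 1 + ∫ ω, (w n ω - w 0 ω) ^ 2 ∂P := by
        rw [integral_add h0 hs,
          integral_add (hi 0).abs (integrable_const _)]
        simp
    _ ≤ _ := by
        have := h.integral_sub_sq_le (Nat.zero_le n)
        simp only [Nat.cast_zero, zero_add, div_one] at this
        linarith

end IsDampedWalk

end MartingaleTransform

/-! ### Moments of the standard Gaussian law -/

section GaussianMoments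

lemma integral_pow_gaussianReal_zero_one (n : ℕ) :
    ∫ x, x ^ n ∂(gaussianReal 0 1) = iteratedDeriv n (fun t => Real.exp (t ^ 2 / 2)) 0 := by
  have h := iteratedDeriv_mgf_zero (X := fun x : ℝ => x) (μ := gaussianReal 0 1) (by simp) n
  rw [mgf_fun_id_gaussianReal] at h
  simpa using h.symm

lemma hasDerivAt_mul_exp_sq_half {f : ℝ → ℝ} {f' t : ℝ} (hf : HasDerivAt f f' t) :
    HasDerivAt (fun t => f t * Real.exp (t ^ 2 / 2)) ((f' + f t * t) * Real.exp (t ^ 2 / 2)) t := by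
  have h1 : HasDerivAt (fun t : ℝ => t ^ 2 / 2) t t := by
    simpa using (hasDerivAt_pow 2 t).div_const 2
  refine (hf.mul h1.exp).congr_deriv ?_
  ring

lemma integral_sq_gaussianReal_zero_one : ∫ x, x ^ 2 ∂(gaussianReal 0 1) = 1 := by
  have h := variance_eq_integral (μ := gaussianReal 0 1) (X := fun x => x) (by fun_prop)
  rw [variance_fun_id_gaussianReal, integral_id_gaussianReal] at h
  simpa using h.symm

lemma integral_pow_four_gaussianReal_zero_one : ∫ x, x ^ 4 ∂(gaussianReal 0 1) = 3 := by
  have d1 : deriv (fun t => Real.exp (t ^ 2 / 2)) = fun t => t * Real.exp (t ^ 2 / 2) := by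
    ext t
    simpa using (hasDerivAt_mul_exp_sq_half (hasDerivAt_const t (1 : ℝ))).deriv
  have d2 : deriv (fun t => t * Real.exp (t ^ 2 / 2))
      = fun t => (1 + t ^ 2) * Real.exp (t ^ 2 / 2) := by
    ext t
    rw [(hasDerivAt_mul_exp_sq_half (hasDerivAt_id' t)).deriv]
    ring
  have d3 : deriv (fun t => (1 + t ^ 2) * Real.exp (t ^ 2 / 2))
      = fun t => (3 * t + t ^ 3) * Real.exp (t ^ 2 / 2) := by
    ext t
    rw [(hasDerivAt_mul_exp_sq_half ((hasDerivAt_pow 2 t).const_add 1)).deriv]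
    push_cast
    ring
  have d4 : deriv (fun t => (3 * t + t ^ 3) * Real.exp (t ^ 2 / 2))
      = fun t => (3 + 6 * t ^ 2 + t ^ 4) * Real.exp (t ^ 2 / 2) := by
    ext t
    have hf : HasDerivAt (fun t : ℝ => 3 * t + t ^ 3) (3 + 3 * t ^ 2) t := by
      simpa using! ((hasDerivAt_id' t).const_mul 3).add (hasDerivAt_pow 3 t)
    rw [(hasDerivAt_mul_exp_sq_half hf).deriv]
    ring
  rw [integral_pow_gaussianReal_zero_one]
  simp only [iteratedDeriv_succ, iteratedDeriv_zero, d1, d2, d3, d4]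
  simp

lemma integral_sq_sub_one_sq_gaussianReal_zero_one :
    ∫ x, (x ^ 2 - 1) ^ 2 ∂(gaussianReal 0 1) = 2 := by
  have h2 : Integrable (fun x : ℝ => x ^ 2) (gaussianReal 0 1) :=
    (memLp_id_gaussianReal' 2 (by simp)).integrable_sq
  have h4 : Integrable (fun x : ℝ => x ^ 4) (gaussianReal 0 1) := by
    have := (memLp_id_gaussianReal' (μ := 0) (v := 1) 4 (by simp)).integrable_norm_pow (p := 4)
      (by norm_num)
    refine this.congr (Eventually.of_forall fun x => ?_)
    simp [Even.pow_abs (by decide : Even 4)]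
  have e : ∀ x : ℝ, (x ^ 2 - 1) ^ 2 = x ^ 4 - 2 * x ^ 2 + 1 := fun x => by ring
  have h42 : Integrable (fun x : ℝ => x ^ 4 - 2 * x ^ 2) (gaussianReal 0 1) :=
    h4.sub (h2.const_mul 2)
  simp only [e]
  rw [integral_add h42 (integrable_const _), integral_sub h4 (h2.const_mul 2),
    integral_const_mul, integral_pow_four_gaussianReal_zero_one, integral_sq_gaussianReal_zero_one]
  simp
  norm_num

end GaussianMoments

/-- Discrete Grönwall: the product of the factors is at most exp(∑ c/(k+1)²) ≤ exp(2c), by the same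
telescoping as for the martingale tails. -/
lemma exists_bound_of_succ_le_mul {b : ℕ → ℝ} {c : ℝ} (hc : 0 ≤ c) (hb : ∀ k, 0 ≤ b k)
    (h : ∀ k, b (k + 1) ≤ (1 + c / (k + 1) ^ 2) * b k) : ∃ K, ∀ k, b k ≤ K := by
  have key : ∀ k : ℕ, b k ≤ b 0 * Real.exp (2 * c - 2 * c / (k + 1)) := fun k => by
    induction k with
    | zero => simp
    | succ k ih =>
      have h1 : c / (k + 1) ^ 2 ≤ 2 * c / (k + 1) - 2 * c / ((k + 1 : ℕ) + 1) := by
        have : 2 * c / (k + 1) - 2 * c / ((k + 1 : ℕ) + 1) - c / (k + 1) ^ 2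
            = c * (k / ((k + 1) ^ 2 * (k + 2))) := by
          push_cast
          field_simp
          ring
        rw [← sub_nonneg, this]
        positivity
      calc b (k + 1) ≤ (1 + c / (k + 1) ^ 2) * b k := h k
        _ ≤ Real.exp (c / (k + 1) ^ 2) * (b 0 * Real.exp (2 * c - 2 * c / (k + 1))) := by
          refine mul_le_mul ?_ ih (hb k) (Real.exp_pos _).le
          linarith [Real.add_one_le_exp (c / (k + 1 : ℝ) ^ 2)]
        _ = b 0 * Real.exp (c / (k + 1) ^ 2 + (2 * c - 2 * c / (k + 1))) := by
          rw [Real.exp_add]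
          ring
        _ ≤ _ := by
          refine mul_le_mul_of_nonneg_left (Real.exp_le_exp.2 ?_) (hb 0)
          linarith
  refine ⟨b 0 * Real.exp (2 * c), fun k => (key k).trans ?_⟩
  refine mul_le_mul_of_nonneg_left (Real.exp_le_exp.2 ?_) (hb 0)
  have : 0 ≤ 2 * c / (k + 1 : ℝ) := by positivity
  linarith

/-! ### The mean and variance processes driven by Gaussian noise -/

section GaussianNoise

variable {Ω : Type*}

/-- The normalized empirical variances driven by the noise `Z`. -/
def scaleProc (Z : ℕ → Ω → ℝ) : ℕ → Ω → ℝ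
  -- The points 0 and 1 have variance 1/4, and the normalization n/(n+1) at n = 2 is 2/3.
  | 0, _ => 1 / 6
  | k + 1, ω => scaleProc Z k ω * (1 + (Z k ω ^ 2 - 1) / (k + 4))

/-- The empirical means driven by the noise `Z`. -/
def locProc (Z : ℕ → Ω → ℝ) : ℕ → Ω → ℝ
  | 0, _ => 1 / 2
  | k + 1, ω => locProc Z k ω + √((k + 3) / (k + 2) * scaleProc Z k ω) * Z k ω / (k + 3)

/-- The worst case is z = 0, k = 0. This keeps the variance positive and the inverse factors
bounded. -/
lemma three_quarters_le_scale_factor (z : ℝ) (k : ℕ) : 3 / 4 ≤ 1 + (z ^ 2 - 1) / (k + 4) := by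
  have h : -(1 / 4) ≤ (z ^ 2 - 1) / ((k : ℝ) + 4) := by
    rw [le_div_iff₀ (by positivity)]
    have : (0 : ℝ) ≤ k := by positivity
    nlinarith [sq_nonneg z]
  linarith

lemma scaleProc_pos (Z : ℕ → Ω → ℝ) (k : ℕ) (ω : Ω) : 0 < scaleProc Z k ω := by
  induction k with
  | zero => norm_num [scaleProc]
  | succ k ih => exact mul_pos ih (by linarith [three_quarters_le_scale_factor (Z k ω) k])

variable [mΩ : MeasurableSpace Ω]

/-- `Z` is a sequence of standard Gaussian variables, each of them independent of the past. -/
structure IsGaussianNoise (P : Measure Ω) (ℱ : Filtration ℕ mΩ) (Z : ℕ → Ω → ℝ) : Prop where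
  measurable : ∀ k, Measurable[ℱ (k + 1)] (Z k)
  indep : ∀ k, Indep (ℱ k) (MeasurableSpace.comap (Z k) inferInstance) P
  law : ∀ k, P.map (Z k) = gaussianReal 0 1

namespace IsGaussianNoise

variable {P : Measure Ω} {ℱ : Filtration ℕ mΩ} {Z : ℕ → Ω → ℝ}

lemma measurable' (h : IsGaussianNoise P ℱ Z) (k : ℕ) : Measurable (Z k) :=
  (h.measurable k).mono (ℱ.le _) le_rfl

lemma integral_comp (h : IsGaussianNoise P ℱ Z) (k : ℕ) {f : ℝ → ℝ} (hf : Measurable f) :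
    ∫ ω, f (Z k ω) ∂P = ∫ x, f x ∂(gaussianReal 0 1) := by
  rw [← h.law k, integral_map (h.measurable' k).aemeasurable hf.aestronglyMeasurable]

lemma memLp (h : IsGaussianNoise P ℱ Z) (k : ℕ) (q : NNReal) : MemLp (Z k) q P := by
  have := memLp_id_gaussianReal (μ := 0) (v := 1) q
  rw [← h.law k, memLp_map_measure_iff (by fun_prop) (h.measurable' k).aemeasurable] at this
  exact this

lemma integral_eq_zero (h : IsGaussianNoise P ℱ Z) (k : ℕ) : ∫ ω, Z k ω ∂P = 0 := by
  refine (h.integral_comp k measurable_id).trans ?_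
  exact integral_id_gaussianReal

lemma integral_sq (h : IsGaussianNoise P ℱ Z) (k : ℕ) : ∫ ω, Z k ω ^ 2 ∂P = 1 := by
  rw [h.integral_comp k (f := fun x => x ^ 2) (by fun_prop), integral_sq_gaussianReal_zero_one]

lemma integral_sq_sub_one_sq (h : IsGaussianNoise P ℱ Z) (k : ℕ) :
    ∫ ω, (Z k ω ^ 2 - 1) ^ 2 ∂P = 2 := by
  rw [h.integral_comp k (f := fun x => (x ^ 2 - 1) ^ 2) (by fun_prop),
    integral_sq_sub_one_sq_gaussianReal_zero_one]

lemma indep_comp (h : IsGaussianNoise P ℱ Z) (k : ℕ) {f : ℝ → ℝ} (hf : Measurable f) :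
    Indep (ℱ k) (MeasurableSpace.comap (fun ω => f (Z k ω)) inferInstance) P :=
  indep_of_indep_of_le_right (h.indep k) (hf.comp (comap_measurable (Z k))).comap_le

lemma measurable_scaleProc (h : IsGaussianNoise P ℱ Z) (k : ℕ) :
    Measurable[ℱ k] (scaleProc Z k) := by
  induction k with
  | zero => exact measurable_const
  | succ k ih =>
    exact (ih.mono (ℱ.mono k.le_succ) le_rfl).mul
      (((((h.measurable k).pow_const 2).sub_const 1).div_const _).const_add 1)

lemma memLp_sq_sub_one (h : IsGaussianNoise P ℱ Z) (k : ℕ) :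
    MemLp (fun ω => Z k ω ^ 2 - 1) 2 P := by
  have hm := h.measurable' k
  rw [memLp_two_iff_integrable_sq (by fun_prop)]
  -- A non-integrable function would have integral 0 by convention, whereas this integral is 2.
  by_contra hn
  have := h.integral_sq_sub_one_sq k
  rw [integral_undef hn] at this
  norm_num at this

lemma indepFun_scale_factor (h : IsGaussianNoise P ℱ Z) (k : ℕ) :
    IndepFun (scaleProc Z k) (fun ω => 1 + (Z k ω ^ 2 - 1) / (k + 4)) P :=
  indepFun_of_measurable (h.measurable_scaleProc k)
    (h.indep_comp k (f := fun x => 1 + (x ^ 2 - 1) / (k + 4)) (by fun_prop))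

variable [IsProbabilityMeasure P]

lemma integral_sq_sub_one (h : IsGaussianNoise P ℱ Z) (k : ℕ) :
    ∫ ω, (Z k ω ^ 2 - 1) ∂P = 0 := by
  rw [integral_sub (h.memLp k 2).integrable_sq (integrable_const _), h.integral_sq]
  simp

lemma memLp_scale_factor (h : IsGaussianNoise P ℱ Z) (k : ℕ) :
    MemLp (fun ω => 1 + (Z k ω ^ 2 - 1) / (k + 4)) 2 P := by
  have := (memLp_const (1 : ℝ)).add ((h.memLp_sq_sub_one k).mul_const ((k + 4 : ℝ)⁻¹))
  simpa only [div_eq_mul_inv] using! this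

lemma memLp_scaleProc (h : IsGaussianNoise P ℱ Z) (k : ℕ) : MemLp (scaleProc Z k) 2 P := by
  induction k with
  | zero => exact memLp_const _
  | succ k ih =>
    exact memLp_two_mul_of_indepFun ih (h.memLp_scale_factor k) (h.indepFun_scale_factor k)

lemma integral_scale_factor_sq (h : IsGaussianNoise P ℱ Z) (k : ℕ) :
    ∫ ω, (1 + (Z k ω ^ 2 - 1) / (k + 4)) ^ 2 ∂P = 1 + 2 / ((k : ℝ) + 4) ^ 2 := by
  have e : ∀ ω, (1 + (Z k ω ^ 2 - 1) / ((k : ℝ) + 4)) ^ 2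
      = 1 + 2 / ((k : ℝ) + 4) * (Z k ω ^ 2 - 1) + (1 / ((k : ℝ) + 4) ^ 2) * (Z k ω ^ 2 - 1) ^ 2 :=
    fun ω => by
      field_simp
      ring
  have h1 : Integrable (fun ω => 2 / ((k : ℝ) + 4) * (Z k ω ^ 2 - 1)) P :=
    ((h.memLp_sq_sub_one k).integrable (by norm_num)).const_mul _
  have h2 : Integrable (fun ω => (1 / ((k : ℝ) + 4) ^ 2) * (Z k ω ^ 2 - 1) ^ 2) P :=
    (h.memLp_sq_sub_one k).integrable_sq.const_mul _
  have h3 : Integrable (fun ω => 1 + 2 / ((k : ℝ) + 4) * (Z k ω ^ 2 - 1)) P :=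
    (integrable_const _).add h1
  simp only [e]
  rw [integral_add h3 h2, integral_add (integrable_const _) h1, integral_const_mul,
    integral_const_mul, h.integral_sq_sub_one, h.integral_sq_sub_one_sq]
  simp
  ring

lemma exists_integral_scaleProc_sq_le (h : IsGaussianNoise P ℱ Z) :
    ∃ C, ∀ k, ∫ ω, scaleProc Z k ω ^ 2 ∂P ≤ C := by
  refine exists_bound_of_succ_le_mul (c := 2) (by norm_num)
    (fun k => integral_nonneg fun _ => sq_nonneg _) fun k => ?_
  have : ∫ ω, scaleProc Z (k + 1) ω ^ 2 ∂P
      = (∫ ω, scaleProc Z k ω ^ 2 ∂P) * (1 + 2 / ((k : ℝ) + 4) ^ 2) := by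
    rw [← h.integral_scale_factor_sq k]
    exact integral_mul_sq_of_indepFun (h.memLp_scaleProc k) (h.memLp_scale_factor k)
      (h.indepFun_scale_factor k)
  rw [this, mul_comm]
  have h0 : 0 ≤ ∫ ω, scaleProc Z k ω ^ 2 ∂P := integral_nonneg fun _ => sq_nonneg _
  gcongr
  norm_num

/-- The increment is U (Z² - 1)/(k+4); the ratio (k+1)/(k+4) in the coefficient only restores the
step 1/(k+1). -/
lemma isDampedWalk_scaleProc (h : IsGaussianNoise P ℱ Z) :
    ∃ C, IsDampedWalk P ℱ (scaleProc Z) (fun k ω => (k + 1) / (k + 4) * scaleProc Z k ω)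
      (fun k ω => Z k ω ^ 2 - 1) C 2 := by
  obtain ⟨C, hC⟩ := h.exists_integral_scaleProc_sq_le
  refine ⟨C, measurable_const, memLp_const _, fun k => (h.measurable_scaleProc k).const_mul _,
    fun k => (h.memLp_scaleProc k).const_mul _, fun k => le_trans ?_ (hC k),
    fun k => ((h.measurable k).pow_const 2).sub_const 1, h.memLp_sq_sub_one,
    h.integral_sq_sub_one, fun k => (h.integral_sq_sub_one_sq k).le,
    fun k => h.indep_comp k (f := fun x => x ^ 2 - 1) (by fun_prop), fun k ω => ?_⟩
  · refine integral_mono ((h.memLp_scaleProc k).const_mul _).integrable_sq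
      (h.memLp_scaleProc k).integrable_sq fun ω => ?_
    have h1 : ((k : ℝ) + 1) / (k + 4) ≤ 1 := by
      rw [div_le_one (by positivity)]
      linarith
    have := (scaleProc_pos Z k ω).le
    have : (k + 1) / (k + 4) * scaleProc Z k ω ≤ scaleProc Z k ω := by nlinarith
    exact pow_le_pow_left₀ (by positivity) this 2
  · rw [scaleProc]
    field_simp

lemma isDampedWalk_locProc (h : IsGaussianNoise P ℱ Z) :
    ∃ C, IsDampedWalk P ℱ (locProc Z)
      (fun k ω => (k + 1) / (k + 3) * √((k + 3) / (k + 2) * scaleProc Z k ω)) Z C 1 := by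
  obtain ⟨C, hC⟩ := h.exists_integral_scaleProc_sq_le
  have hsq : ∀ (k : ℕ) ω, ((k + 1) / (k + 3) * √((k + 3) / (k + 2) * scaleProc Z k ω)) ^ 2
      = (k + 1 : ℝ) ^ 2 / ((k + 3) * (k + 2)) * scaleProc Z k ω := fun k ω => by
    have := (scaleProc_pos Z k ω).le
    rw [mul_pow, Real.sq_sqrt (by positivity)]
    field_simp
  have hm : ∀ k : ℕ, Measurable[ℱ k]
      fun ω => (k + 1) / (k + 3) * √((k + 3) / (k + 2) * scaleProc Z k ω) := fun k =>
    ((h.measurable_scaleProc k).const_mul _).sqrt.const_mul _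
  have hL : ∀ k : ℕ,
      MemLp (fun ω => (k + 1) / (k + 3) * √((k + 3) / (k + 2) * scaleProc Z k ω)) 2 P := fun k => by
    rw [memLp_two_iff_integrable_sq ((hm k).mono (ℱ.le k) le_rfl).aestronglyMeasurable]
    simp only [hsq]
    exact ((h.memLp_scaleProc k).integrable (by norm_num)).const_mul _
  -- The squared coefficient is at most U, and U ≤ 1 + U² reduces the bound to the second moment.
  refine ⟨1 + C, measurable_const, memLp_const _, hm, hL, fun k => ?_, h.measurable,
    fun k => h.memLp k 2, h.integral_eq_zero, fun k => (h.integral_sq k).le, h.indep, fun k ω => ?_⟩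
  · have hi : Integrable (fun ω => 1 + scaleProc Z k ω ^ 2) P :=
      (integrable_const _).add (h.memLp_scaleProc k).integrable_sq
    calc _ ≤ ∫ ω, (1 + scaleProc Z k ω ^ 2) ∂P := by
          refine integral_mono (hL k).integrable_sq hi fun ω => ?_
          simp only [hsq]
          have h1 : (k + 1 : ℝ) ^ 2 / ((k + 3) * (k + 2)) ≤ 1 := by
            rw [div_le_one (by positivity)]
            have : (0 : ℝ) ≤ k := by positivity
            nlinarith
          have := (scaleProc_pos Z k ω).le
          nlinarith [sq_nonneg (scaleProc Z k ω - 1)]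
      _ ≤ 1 + C := by
          rw [integral_add (integrable_const _) (h.memLp_scaleProc k).integrable_sq]
          simpa using hC k
  · rw [locProc]
    field_simp

lemma integrable_inv_scale_factor (h : IsGaussianNoise P ℱ Z) (k : ℕ) :
    Integrable (fun ω => (1 + (Z k ω ^ 2 - 1) / ((k : ℝ) + 4))⁻¹) P := by
  have hm := h.measurable' k
  refine Integrable.of_bound (by fun_prop) (4 / 3) (Eventually.of_forall fun ω => ?_)
  have := three_quarters_le_scale_factor (Z k ω) k
  rw [Real.norm_eq_abs, abs_of_nonneg (by positivity)]
  rw [inv_le_comm₀ (by linarith) (by norm_num)]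
  linarith

/-- For x ≥ -1/4 one has 1/(1+x) ≤ 1 - x + (4/3)x². The linear term integrates to zero, leaving a
summable correction. -/
lemma integral_inv_scale_factor_le (h : IsGaussianNoise P ℱ Z) (k : ℕ) :
    ∫ ω, (1 + (Z k ω ^ 2 - 1) / ((k : ℝ) + 4))⁻¹ ∂P ≤ 1 + 3 / ((k : ℝ) + 1) ^ 2 := by
  have h1 : Integrable (fun ω => 1 / ((k : ℝ) + 4) * (Z k ω ^ 2 - 1)) P :=
    ((h.memLp_sq_sub_one k).integrable (by norm_num)).const_mul _
  have h2 : Integrable (fun ω => 4 / 3 / ((k : ℝ) + 4) ^ 2 * (Z k ω ^ 2 - 1) ^ 2) P :=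
    (h.memLp_sq_sub_one k).integrable_sq.const_mul _
  have h3 : Integrable (fun ω => 1 - 1 / ((k : ℝ) + 4) * (Z k ω ^ 2 - 1)) P :=
    (integrable_const _).sub h1
  calc _ ≤ ∫ ω, (1 - 1 / ((k : ℝ) + 4) * (Z k ω ^ 2 - 1)
        + 4 / 3 / ((k : ℝ) + 4) ^ 2 * (Z k ω ^ 2 - 1) ^ 2) ∂P := by
        refine integral_mono (h.integrable_inv_scale_factor k) (h3.add h2) fun ω => ?_
        have hx := three_quarters_le_scale_factor (Z k ω) k
        have e : 1 - 1 / ((k : ℝ) + 4) * (Z k ω ^ 2 - 1)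
            + 4 / 3 / ((k : ℝ) + 4) ^ 2 * (Z k ω ^ 2 - 1) ^ 2
            = 1 - (Z k ω ^ 2 - 1) / ((k : ℝ) + 4) +
              4 / 3 * ((Z k ω ^ 2 - 1) / ((k : ℝ) + 4)) ^ 2 := by
          rw [div_pow]
          ring
        simp only [e]
        generalize (Z k ω ^ 2 - 1) / ((k : ℝ) + 4) = x at hx
        rw [inv_le_iff_one_le_mul₀ (by linarith)]
        nlinarith [mul_nonneg (sq_nonneg x) (sub_nonneg.2 hx)]
    _ = 1 + 8 / 3 / ((k : ℝ) + 4) ^ 2 := by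
        rw [integral_add h3 h2, integral_sub (integrable_const _) h1, integral_const_mul,
          integral_const_mul, h.integral_sq_sub_one, h.integral_sq_sub_one_sq]
        simp
        ring
    _ ≤ _ := by
        gcongr <;> norm_num

lemma integrable_inv_scaleProc (h : IsGaussianNoise P ℱ Z) (k : ℕ) :
    Integrable (fun ω => (scaleProc Z k ω)⁻¹) P := by
  induction k with
  | zero => exact integrable_const (1 / 6 : ℝ)⁻¹
  | succ k ih =>
    have := ((h.indepFun_scale_factor k).comp measurable_inv measurable_inv).integrable_mul ih
      (h.integrable_inv_scale_factor k)
    refine this.congr (Eventually.of_forall fun ω => ?_)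
    simp [scaleProc, mul_comm]

lemma exists_integral_inv_scaleProc_le (h : IsGaussianNoise P ℱ Z) :
    ∃ C, ∀ k, ∫ ω, (scaleProc Z k ω)⁻¹ ∂P ≤ C := by
  have h0 : ∀ k, 0 ≤ ∫ ω, (scaleProc Z k ω)⁻¹ ∂P := fun k =>
    integral_nonneg fun ω => (inv_pos.2 (scaleProc_pos Z k ω)).le
  refine exists_bound_of_succ_le_mul (c := 3) (by norm_num) h0 fun k => ?_
  have e : ∀ ω, (scaleProc Z (k + 1) ω)⁻¹
      = (scaleProc Z k ω)⁻¹ * (1 + (Z k ω ^ 2 - 1) / ((k : ℝ) + 4))⁻¹ := fun ω => by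
    rw [scaleProc, mul_inv]
  have := ((h.indepFun_scale_factor k).comp measurable_inv
    measurable_inv).integral_fun_mul_eq_mul_integral
      (h.integrable_inv_scaleProc k).1 (h.integrable_inv_scale_factor k).1
  simp only [Function.comp_apply] at this
  simp only [e]
  rw [this, mul_comm]
  exact mul_le_mul_of_nonneg_right (h.integral_inv_scale_factor_le k) (h0 k)

/-- The limit of the empirical variances does not vanish. -/
lemma ae_limit_scaleProc_pos (h : IsGaussianNoise P ℱ Z) {V : Ω → ℝ}
    (hV : ∀ᵐ ω ∂P, Tendsto (fun k => scaleProc Z k ω) atTop (𝓝 (V ω))) : ∀ᵐ ω ∂P, 0 < V ω := by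
  obtain ⟨C, hC⟩ := h.exists_integral_inv_scaleProc_le
  have hm : ∀ k, Measurable fun ω => ENNReal.ofReal (scaleProc Z k ω)⁻¹ := fun k =>
    ((h.measurable_scaleProc k).mono (ℱ.le k) le_rfl).inv.ennreal_ofReal
  have hle : ∫⁻ ω, liminf (fun k => ENNReal.ofReal (scaleProc Z k ω)⁻¹) atTop ∂P
      ≤ ENNReal.ofReal C := by
    refine (lintegral_liminf_le hm).trans
      (liminf_le_of_frequently_le' (Eventually.frequently (Eventually.of_forall fun k => ?_)))
    rw [← ofReal_integral_eq_lintegral_ofReal (h.integrable_inv_scaleProc k)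
      (Eventually.of_forall fun ω => (inv_pos.2 (scaleProc_pos Z k ω)).le)]
    exact ENNReal.ofReal_le_ofReal (hC k)
  -- By Fatou the lower limit of 1/U is a.s. finite, whereas a vanishing limit of U would make it
  -- infinite.
  have hlt := ae_lt_top (Measurable.liminf hm) (hle.trans_lt ENNReal.ofReal_lt_top).ne
  filter_upwards [hlt, hV] with ω h1 h2
  have h3 : 0 ≤ V ω := ge_of_tendsto' h2 fun k => (scaleProc_pos Z k ω).le
  refine lt_of_le_of_ne h3 fun h4 => h1.ne ?_
  refine Tendsto.liminf_eq ?_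
  refine ENNReal.tendsto_ofReal_atTop.comp (tendsto_inv_nhdsGT_zero.comp ?_)
  refine tendsto_nhdsWithin_iff.2 ⟨?_, Eventually.of_forall fun k => scaleProc_pos Z k ω⟩
  rw [h4]
  exact h2

end IsGaussianNoise

end GaussianNoise

/-! ### Identifying the driven processes with the empirical ones -/

section Coordinates

variable {p : ℕ} {Ω : Type*} {X : ℕ → Ω → EuclideanSpace ℝ (Fin p)}

/-- Bridge between the two descriptions, valid pathwise: it is pure algebra from the recursions,
with no probability involved. -/
lemma procs_innovation {ω : Ω} (h : X 1 ω ≠ X 0 ω) (k : ℕ) :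
    scaleProc (innovation X) k ω = (k + 2) / (k + 3) * seqVar (obsCoord X ω) (k + 2) ∧
      locProc (innovation X) k ω = seqMean (obsCoord X ω) (k + 2) := by
  have t0 : obsCoord X ω 0 = 0 := lineCoord_self _ _
  have t1 : obsCoord X ω 1 = 1 := lineCoord_right h
  induction k with
  | zero =>
    have hm : seqMean (obsCoord X ω) 2 = 1 / 2 := by
      simp [seqMean, Finset.sum_range_succ, t0, t1]
    have hv : seqVar (obsCoord X ω) 2 = 1 / 4 := by
      simp [seqVar, hm, Finset.sum_range_succ, t0, t1]
      norm_num
    simp only [zero_add, hm, hv, scaleProc, locProc]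
    norm_num
  | succ k ih =>
    have hq := seqVar_obsCoord_pos h (by omega : 2 ≤ k + 2)
    have hz : obsCoord X ω (k + 2) - seqMean (obsCoord X ω) (k + 2)
        = √(seqVar (obsCoord X ω) (k + 2)) * innovation X k ω := by
      rw [innovation]
      field_simp
    have hU : ((k : ℝ) + 3) / (k + 2) * scaleProc (innovation X) k ω
        = seqVar (obsCoord X ω) (k + 2) := by
      rw [ih.1]
      field_simp
    constructor
    · rw [scaleProc, ih.1, seqVar_succ _ (by omega : k + 2 ≠ 0), hz, mul_pow, Real.sq_sqrt hq.le]
      push_cast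
      field_simp
      ring
    · rw [locProc, hU, ih.2, seqMean_succ _ (k + 2), hz]
      push_cast
      ring

variable [MeasurableSpace Ω] {P : Measure Ω} [IsProbabilityMeasure P]

lemma isGaussianNoise_innovation (hp : 1 ≤ p) (hX : ∀ n, Measurable (X n))
    (hα : HasPredictives P X (gaussianPredictive X)) :
    IsGaussianNoise P (obsFiltration hX) (innovation X) where
  measurable _ := measurable_innovation fun _ hi => measurable_obs_comap X hi
  indep k := (innovation_indep_law hp hX hα k).1
  law k := (innovation_indep_law hp hX hα k).2

end Coordinates

/-! ### Convergence in measure and rates -/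

section ConvergenceInMeasure

variable {Ω : Type*} [MeasurableSpace Ω] {P : Measure Ω}

/-- No measurability of `f` is asked, so this applies to the total variation distance, a supremum
over possibly uncountably many sets. -/
lemma tendstoInMeasure_zero_of_ae_le {f g : ℕ → Ω → ℝ} (h : ∀ n, ∀ᵐ ω ∂P, |f n ω| ≤ |g n ω|)
    (hg : TendstoInMeasure P g atTop fun _ => 0) : TendstoInMeasure P f atTop fun _ => 0 := by
  rw [tendstoInMeasure_iff_norm] at hg ⊢
  intro ε hε
  refine tendsto_of_tendsto_of_tendsto_of_le_of_le tendsto_const_nhds (hg ε hε)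
    (fun _ => zero_le) fun n => measure_mono_ae ?_
  filter_upwards [h n] with ω hω hε'
  have h1 : ε ≤ ‖f n ω - 0‖ := hε'
  have h2 : ε ≤ ‖g n ω - 0‖ := by
    simp only [sub_zero, Real.norm_eq_abs] at h1 ⊢
    exact h1.trans hω
  exact h2

/-- Convergence in measure follows from almost sure convergence whenever two sequences that
converge in measure do so almost surely. -/
lemma tendstoInMeasure_of_subseq [IsFiniteMeasure P] {A B Y : ℕ → Ω → ℝ}
    (hA : TendstoInMeasure P A atTop fun _ => 0) (hB : TendstoInMeasure P B atTop fun _ => 0)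
    (hY : ∀ n, AEStronglyMeasurable (Y n) P)
    (h : ∀ᵐ ω ∂P, ∀ ns : ℕ → ℕ, StrictMono ns → Tendsto (fun k => A (ns k) ω) atTop (𝓝 0) →
      Tendsto (fun k => B (ns k) ω) atTop (𝓝 0) → Tendsto (fun k => Y (ns k) ω) atTop (𝓝 0)) :
    TendstoInMeasure P Y atTop fun _ => 0 := by
  rw [exists_seq_tendstoInMeasure_atTop_iff hY]
  intro ns hns
  -- Two nested extractions give one subsequence along which both A and B converge a.s.
  obtain ⟨ms, hms, h1⟩ := (hA.comp hns.tendsto_atTop).exists_seq_tendsto_ae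
  obtain ⟨ls, hls, h2⟩ := (hB.comp (hns.comp hms).tendsto_atTop).exists_seq_tendsto_ae
  refine ⟨ms ∘ ls, hms.comp hls, ?_⟩
  filter_upwards [h, h1, h2] with ω h h1 h2
  exact h _ (hns.comp (hms.comp hls)) (h1.comp hls.tendsto_atTop) h2

end ConvergenceInMeasure

/-- The first rate matches the martingale bound after shifting the index by two; the second absorbs
the factor 1 + 1/(k+2) between U and the empirical variance. -/
lemma tendsto_rate_shift {d : ℕ → ℝ} (hd : Tendsto (fun n => d n / √(n : ℝ)) atTop (𝓝 0)) :
    Tendsto (fun k : ℕ => d (k + 2) / √((k : ℝ) + 1)) atTop (𝓝 0) ∧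
      Tendsto (fun k : ℕ => d (k + 2) / ((k : ℝ) + 2)) atTop (𝓝 0) := by
  have h1 : Tendsto (fun k : ℕ => d (k + 2) / √((k : ℝ) + 2)) atTop (𝓝 0) := by
    have := (tendsto_add_atTop_iff_nat 2).2 hd
    simpa using this
  have h2 : Tendsto (fun k : ℕ => 2 * |d (k + 2) / √((k : ℝ) + 2)|) atTop (𝓝 0) := by
    simpa using h1.abs.const_mul 2
  constructor
  · refine squeeze_zero_norm (fun k => ?_) h2
    rw [Real.norm_eq_abs, abs_div, abs_div, abs_of_nonneg (Real.sqrt_nonneg _),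
      abs_of_nonneg (Real.sqrt_nonneg _), ← mul_div_assoc, div_le_div_iff₀ (by positivity)
      (by positivity)]
    have : √((k : ℝ) + 2) ≤ 2 * √((k : ℝ) + 1) := by
      rw [Real.sqrt_le_left (by positivity), mul_pow, Real.sq_sqrt (by positivity)]
      have : (0 : ℝ) ≤ k := by positivity
      linarith
    nlinarith [abs_nonneg (d (k + 2))]
  · refine squeeze_zero_norm (fun k => ?_) h2
    rw [Real.norm_eq_abs, abs_div, abs_div, abs_of_nonneg (Real.sqrt_nonneg _),
      abs_of_nonneg (by positivity : (0 : ℝ) ≤ k + 2), ← mul_div_assoc]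
    have h3 : √((k : ℝ) + 2) ≤ k + 2 := by
      rw [Real.sqrt_le_left (by positivity)]
      have : (0 : ℝ) ≤ k := by positivity
      nlinarith
    rw [div_le_div_iff₀ (by positivity) (by positivity)]
    nlinarith [abs_nonneg (d (k + 2)), Real.sqrt_nonneg ((k : ℝ) + 2)]

/-! ### Limits and rate for the predictive distributions -/

section Limits

variable {p : ℕ} {Ω : Type*} [MeasurableSpace Ω] {P : Measure Ω} [IsProbabilityMeasure P]
  {X : ℕ → Ω → EuclideanSpace ℝ (Fin p)}

/-- The empirical means converge, the empirical covariance matrices converge, and the rescaled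
distance of the predictive distributions to their limit is negligible. -/
lemma exists_limits (hp : 1 ≤ p) (hX : ∀ n, Measurable (X n))
    (hα : HasPredictives P X (gaussianPredictive X)) :
    ∃ W V : Ω → ℝ, Measurable W ∧ Measurable V ∧
      (∀ᵐ ω ∂P, Tendsto (fun n => sampleMean X n ω) atTop
        (𝓝 (X 0 ω + W ω • (X 1 ω - X 0 ω)))) ∧
      (∀ᵐ ω ∂P, Tendsto (fun n => sampleCov X n ω) atTop
        (𝓝 (V ω • Matrix.vecMulVec (X 1 ω - X 0 ω).ofLp (X 1 ω - X 0 ω).ofLp))) ∧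
      ∀ d : ℕ → ℝ, Tendsto (fun n => d n / √(n : ℝ)) atTop (𝓝 0) →
        TendstoInMeasure P (fun n ω => d n * tvDist (gaussianPredictive X n ω)
          (multivariateGaussian (X 0 ω + W ω • (X 1 ω - X 0 ω))
            (V ω • Matrix.vecMulVec (X 1 ω - X 0 ω).ofLp (X 1 ω - X 0 ω).ofLp)))
          atTop fun _ => 0 := by
  have hN := isGaussianNoise_innovation hp hX hα
  set U := scaleProc (innovation X) with hU_def
  set m := locProc (innovation X) with hm_def
  obtain ⟨CU, hU⟩ := hN.isDampedWalk_scaleProc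
  obtain ⟨Cm, hm⟩ := hN.isDampedWalk_locProc
  obtain ⟨V, hVm, hVlim⟩ := hU.exists_ae_tendsto
  obtain ⟨W, hWm, hWlim⟩ := hm.exists_ae_tendsto
  have hUm : ∀ k, Measurable (U k) := fun k => (hU.measurable k).mono (Filtration.le _ k) le_rfl
  have hmm : ∀ k, Measurable (m k) := fun k => (hm.measurable k).mono (Filtration.le _ k) le_rfl
  have hVpos := hN.ae_limit_scaleProc_pos hVlim
  have hq : ∀ {ω}, X 1 ω ≠ X 0 ω → ∀ k : ℕ,
      seqVar (obsCoord X ω) (k + 2) = (1 + 1 / ((k : ℝ) + 2)) * U k ω := fun {ω} h k => by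
    rw [hU_def, (procs_innovation h k).1]
    field_simp
    ring
  have hone : Tendsto (fun k : ℕ => 1 + 1 / ((k : ℝ) + 2)) atTop (𝓝 1) := by
    have := (tendsto_add_atTop_iff_nat 2).2 (tendsto_one_div_atTop_nhds_zero_nat (𝕜 := ℝ))
    simpa using this.const_add 1
  refine ⟨W, V, hWm, hVm, ?_, ?_, fun d hd => ?_⟩
  · filter_upwards [ae_forall_obs_mem_line hp hX hα, hWlim] with ω h1 h2
    rw [← tendsto_add_atTop_iff_nat 2]
    have e : ∀ k, sampleMean X (k + 2) ω = X 0 ω + m k ω • (X 1 ω - X 0 ω) := fun k => by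
      rw [sampleMean_of_line (by omega) fun i _ => h1.2 i, hm_def, (procs_innovation h1.1 k).2]
    simp only [e]
    exact (h2.smul_const _).const_add _
  · filter_upwards [ae_forall_obs_mem_line hp hX hα, hVlim] with ω h1 h2
    rw [← tendsto_add_atTop_iff_nat 2]
    have e : ∀ k, sampleCov X (k + 2) ω = ((1 + 1 / ((k : ℝ) + 2)) * U k ω) •
        Matrix.vecMulVec (X 1 ω - X 0 ω).ofLp (X 1 ω - X 0 ω).ofLp := fun k => by
      rw [sampleCov_of_line (by omega) fun i _ => h1.2 i, hq h1.1]
    simp only [e]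
    have := hone.mul h2
    rw [one_mul] at this
    exact this.smul_const _
  obtain ⟨hd1, hd2⟩ := tendsto_rate_shift hd
  -- a measurable bound of the rescaled distances
  set Y : ℕ → Ω → ℝ := fun k ω => 8 * (|d (k + 2) * (W ω - m k ω)| / √(V ω) +
    (|d (k + 2) * (V ω - U k ω)| + |d (k + 2) / (k + 2)| * U k ω) / V ω) with hY_def
  have hY : TendstoInMeasure P Y atTop fun _ => 0 := by
    -- The random factors 1/√V, 1/V and U need not be bounded, but they are harmless for fixed ω,
    -- which is why subsequences are used.
    refine tendstoInMeasure_of_subseq (hm.tendstoInMeasure hWm hWlim hd1)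
      (hU.tendstoInMeasure hVm hVlim hd1)
      (fun n => Measurable.aestronglyMeasurable (by fun_prop)) ?_
    filter_upwards [hVlim] with ω h1 ns hns hA hB
    have h2 := (hd2.comp hns.tendsto_atTop).abs.mul (h1.comp hns.tendsto_atTop)
    have h3 := ((hA.abs.div_const √(V ω)).add ((hB.abs.add h2).div_const (V ω))).const_mul 8
    simp only [abs_zero, zero_div, zero_mul, add_zero, mul_zero] at h3
    exact h3
  suffices h : TendstoInMeasure P (fun k ω => d (k + 2) *
      tvDist (gaussianPredictive X (k + 2) ω)
        (multivariateGaussian (X 0 ω + W ω • (X 1 ω - X 0 ω))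
          (V ω • Matrix.vecMulVec (X 1 ω - X 0 ω).ofLp (X 1 ω - X 0 ω).ofLp)))
      atTop fun _ => 0 from fun ε hε => (tendsto_add_atTop_iff_nat 2).1 (h ε hε)
  refine tendstoInMeasure_zero_of_ae_le (fun k => ?_) hY
  filter_upwards [ae_forall_obs_mem_line hp hX hα, hVpos] with ω h1 hV
  have hVc : ((V ω).toNNReal : ℝ) = V ω := Real.coe_toNNReal _ hV.le
  have hUpos : 0 < U k ω := scaleProc_pos _ _ _
  have hlim : multivariateGaussian (X 0 ω + W ω • (X 1 ω - X 0 ω))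
      (V ω • Matrix.vecMulVec (X 1 ω - X 0 ω).ofLp (X 1 ω - X 0 ω).ofLp)
      = (gaussianReal (W ω) (V ω).toNNReal).map fun t => X 0 ω + t • (X 1 ω - X 0 ω) := by
    rw [← multivariateGaussian_line, hVc]
  have htv : tvDist (gaussianPredictive X (k + 2) ω)
      (multivariateGaussian (X 0 ω + W ω • (X 1 ω - X 0 ω))
        (V ω • Matrix.vecMulVec (X 1 ω - X 0 ω).ofLp (X 1 ω - X 0 ω).ofLp))
      ≤ 8 * (|m k ω - W ω| / √(V ω) + |(1 + 1 / ((k : ℝ) + 2)) * U k ω - V ω| / V ω) := by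
    rw [gaussianPredictive_of_line fun i _ => h1.2 i, hlim]
    refine (tvDist_map_le _ _ (by fun_prop)).trans ?_
    refine (tvDist_gaussianReal_le _ _ _ (Real.toNNReal_pos.2 hV)).trans_eq ?_
    rw [hVc, Real.coe_toNNReal _ (seqVar_nonneg _ _), hq h1.1, hm_def, (procs_innovation h1.1 k).2]
  have hq' : |(1 + 1 / ((k : ℝ) + 2)) * U k ω - V ω| ≤
      |V ω - U k ω| + 1 / ((k : ℝ) + 2) * U k ω := by
    have e : (1 + 1 / ((k : ℝ) + 2)) * U k ω - V ω
        = -(V ω - U k ω) + 1 / ((k : ℝ) + 2) * U k ω := by ring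
    rw [e]
    refine (abs_add_le _ _).trans_eq ?_
    rw [abs_neg, abs_of_nonneg (a := 1 / ((k : ℝ) + 2) * U k ω) (by positivity)]
  refine le_trans ?_ (le_abs_self _)
  rw [abs_mul, abs_of_nonneg (tvDist_nonneg _ _)]
  calc _ ≤ |d (k + 2)| *
        (8 * (|m k ω - W ω| / √(V ω) + (|V ω - U k ω| + 1 / ((k : ℝ) + 2) * U k ω) / V ω)) := by
        refine mul_le_mul_of_nonneg_left (htv.trans ?_) (abs_nonneg _)
        gcongr
    _ = Y k ω := by
        rw [hY_def]
        simp only [abs_mul, abs_div, abs_of_nonneg (by positivity : (0 : ℝ) ≤ k + 2),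
          abs_sub_comm (m k ω)]
        ring

end Limits

end PredictiveGaussian

end

theorem theorem2 {p : ℕ} (hp : 1 ≤ p) {Ω : Type*} [MeasurableSpace Ω]
    (P : Measure Ω) [IsProbabilityMeasure P]
    (X : ℕ → Ω → EuclideanSpace ℝ (Fin p)) (hX : ∀ n, Measurable (X n))
    (hα : PredictiveGaussian.HasPredictives P X (PredictiveGaussian.gaussianPredictive X)) :
    (∃ (M : Ω → EuclideanSpace ℝ (Fin p)) (Q : Ω → Matrix (Fin p) (Fin p) ℝ),
      Measurable M ∧ (∀ i j, Measurable fun ω => Q ω i j) ∧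
      (∀ᵐ ω ∂P, Tendsto (fun n => PredictiveGaussian.sampleMean X n ω) atTop (𝓝 (M ω))) ∧
      (∀ᵐ ω ∂P, Tendsto (fun n => PredictiveGaussian.sampleCov X n ω) atTop (𝓝 (Q ω)))) ∧
    ∀ (M : Ω → EuclideanSpace ℝ (Fin p)) (Q : Ω → Matrix (Fin p) (Fin p) ℝ),
      (∀ᵐ ω ∂P, Tendsto (fun n => PredictiveGaussian.sampleMean X n ω) atTop (𝓝 (M ω))) →
      (∀ᵐ ω ∂P, Tendsto (fun n => PredictiveGaussian.sampleCov X n ω) atTop (𝓝 (Q ω))) →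
      ∀ d : ℕ → ℝ, Tendsto (fun n => d n / √(n : ℝ)) atTop (𝓝 0) →
        TendstoInMeasure P
          (fun n ω => d n * PredictiveGaussian.tvDist
            (PredictiveGaussian.gaussianPredictive X n ω) (multivariateGaussian (M ω) (Q ω)))
          atTop (fun _ => 0) := by
  obtain ⟨W, V, hW, hV, h1, h2, h3⟩ := PredictiveGaussian.exists_limits hp hX hα
  have hX0 := hX 0
  have hX1 := hX 1
  refine ⟨⟨_, _, by fun_prop, fun i j => ?_, h1, h2⟩, fun M Q hM hQ d hd => ?_⟩
  · simp only [Matrix.smul_apply, Matrix.vecMulVec_apply, smul_eq_mul]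
    fun_prop
  -- Any other choice of limits agrees a.s. with the constructed one, by uniqueness of limits.
  · refine (h3 d hd).congr_left fun n => ?_
    filter_upwards [h1, h2, hM, hQ] with ω h1 h2 hM hQ
    rw [tendsto_nhds_unique hM h1, tendsto_nhds_unique hQ h2]
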